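/- Let $1\le n\le L$, $\gamma,\phi_1,\phi_2\in\mathbb C$ with $\phi_1\ne 0$, $\mu_1,\dots,\mu_L\in\mathbb C$, and put $a(x)=\sinh(x+\gamma)$, $b(x)=\sinh x$, $c=\sinh\gamma$. Let $\mathcal R(x)\in\mathrm{End}(\mathbb C^2\otimes\mathbb C^2)$ be the matrix with rows $(a,0,0,0),(0,b,c,0),(0,c,b,0),(0,0,0,a)$, let $$\mathcal T(\lambda)=\mathcal R_{a1}(\lambda-\mu_1)\cdots\mathcal R_{aL}(\lambda-\mu_L)=\begin{pmatrix}A(\lambda)&B(\lambda)\\ C(\lambda)&D(\lambda)\end{pmatrix},$$ with operator entries on $(\mathbb C^2)^{\otimes L}$, let $|0\rangle=\binom10^{\otimes L}$ and $$S_n(\lambda^C|\lambda^B)=\langle 0|\,C(\lambda_1^C)\cdots C(\lambda_n^C)\,B(\lambda_1^B)\cdots B(\lambda_n^B)\,|0\rangle .$$ Let $\lambda^C_1,\dots,\lambda^C_n\in\mathbb C$ be arbitrary, and let $\lambda^B_1,\dots,\lambda^B_n$ be pairwise distinct and satisfy, with non-vanishing denominators, the twisted Bethe ansatz equations $$\prod_{j=1}^{L}\frac{a(\lambda_i^B-\mu_j)}{b(\lambda_i^B-\mu_j)}=(-1)^{n-1}\frac{\phi_2}{\phi_1}\prod_{k\ne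 i}\frac{a(\lambda_i^B-\lambda_k^B)}{a(\lambda_k^B-\lambda_i^B)},\qquad 1\le i\le n .$$ For $w,\bar w\in\mathbb C^n$ put $$R_i=\prod_{k=i}^n\frac{a(w_k-\mu_i)}{b(w_k-\mu_i)}-\prod_{k=i}^n\frac{a(\bar w_k-\mu_i)}{b(\bar w_k-\mu_i)},$$ $$\Lambda_i^{\rm ON}=\frac{(-1)^n}{\prod_{k<i}b(\bar w_i-\mu_k)}\prod_{k=i}^{L}a(w_i-\mu_k)\prod_{k=i+1}^n a(w_k-w_i)+\frac{\phi_2\phi_1^{-1}}{\prod_{k<i}a(\bar w_i-\mu_k)}\prod_{k=i}^{L}b(w_i-\mu_k)\prod_{k=i+1}^n a(w_i-w_k)\prod_{k=1}^{i-1}\frac{a(\bar w_i-\bar w_k)}{a(\bar w_k-\bar w_i)},$$ $$H(w|\bar w)=(-1)^{\frac{n(n+1)}2}c^{2n}\,\frac{\prod_{i=1}^n\prod_{j=1}^L b(\bar w_i-\mu_j)\prod_{i<j}a(\bar w_i-\bar w_j)a(\bar w_j-\mu_i)b(\bar w_j-\bar w_i)}{\prod_{i=1}^n b(\bar w_i-\mu_i)}\;\frac{\prod_{i<j}a(w_j-\mu_i)b(w_j-w_i)}{\prod_{i=1}^n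 b(w_i-\mu_i)}\;\prod_{i=1}^n R_i^{-1}\Lambda_i^{\rm ON}.$$ (1) Let $\Gamma_C$ and $\Gamma_B$ each be the union of the positively oriented boundary circles of finitely many pairwise disjoint closed discs such that every $\lambda_j^C$ (resp. $\lambda_j^B$) lies in the interior of one of the discs, and the closed discs contain no zero of $\prod_j b(z-\lambda_j^C)$ (resp. $\prod_j b(z-\lambda_j^B)$) other than the points $\lambda_j^C$ (resp. $\lambda_j^B$) themselves. Suppose that, whenever all $w_k$ are on $\Gamma_C$ and all $\bar w_k$ on $\Gamma_B$, the numbers $b(w_k-\mu_i)$, $b(\bar w_k-\mu_i)$ $(i\le k)$, $a(\bar w_k-\mu_i)$, $a(\bar w_i-\bar w_k)$ $(i<k)$ are non-zero, and that the contours enclose no poles of $H$ coming from the zeros of the $R_i$: for each $i$, $\prod_{k=i}^n a(w_k-\mu_i)b(\bar w_k-\mu_i)\ne\prod_{k=i}^n a(\bar w_k-\mu_i)b(w_k-\mu_i)$ whenever all $w_k$ lie in the closed discs of $\Gamma_C$ and all $\bar w_k$ in those of $\Gamma_B$. Then $$S_n(\lambda^C|\lambda^B)=\oint_{\Gamma_C}\!\!\cdots\oint_{\Gamma_C}\oint_{\Gamma_B}\!\!\cdots\oint_{\Gamma_B}\prod_{i=1}^n\frac{dw_i}{2\pi\mathrm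 i}\frac{d\bar w_i}{2\pi\mathrm i}\;\frac{H(w_1,\dots,w_n|\bar w_1,\dots,\bar w_n)}{\prod_{i,j=1}^n b(w_i-\lambda_j^C)\,b(\bar w_i-\lambda_j^B)} .$$ (2) Suppose $a(\mu_s-\mu_k)\ne0\ne a(\mu_k-\mu_s)$ for $1\le s<n$, $s<k\le L$. Define $H^{(n)},\dots,H^{(1)}$ by $$H^{(n)}=(-1)^n c^2\,\frac{\prod_{k=1}^L b(\bar w_n-\mu_k)}{b(w_n-\mu_n)b(\bar w_n-\mu_n)}\,R_n^{-1}\Lambda_n^{\rm ON},$$ $$H^{(s)}=\frac{(-1)^L\prod_{k=1}^L b(\bar w_s-\mu_k)\prod_{k=s+1}^n a(w_k-\mu_s)b(w_k-w_s)}{b(w_s-\mu_s)b(\bar w_s-\mu_s)\prod_{k=s+1}^L a(\mu_s-\mu_k)a(\mu_k-\mu_s)}\prod_{k=s+1}^n a(\bar w_s-\bar w_k)a(\bar w_k-\mu_s)b(\bar w_k-\bar w_s)\;R_s^{-1}\Lambda_s^{\rm ON}\,H^{(s+1)}\quad(1\le s\le n-1).$$ Then the kernel is obtained, up to a normalisation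 depending only on $n$, $L$, $\gamma$ and the $\mu_j$, by iterating this recursion: $$H=(-1)^{(n-1)\left(L+\frac n2\right)}c^{2(n-1)}\prod_{s=1}^{n-1}\prod_{k=s+1}^L a(\mu_s-\mu_k)a(\mu_k-\mu_s)\;H^{(1)} .$$ -/

import Mathlib

open Complex

namespace SixVertex

/-! ## The six-vertex weights and the monodromy matrix -/

/-- The weight `a(x) = sinh (x + γ)`. -/
noncomputable def wa (γ x : ℂ) : ℂ := sinh (x + γ)

/-- The weight `b(x) = sinh x`. -/
noncomputable def wb (x : ℂ) : ℂ := sinh x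

/-- The weight `c = sinh γ`. -/
noncomputable def wc (γ : ℂ) : ℂ := sinh γ

/-- The matrix `R(x)` on `ℂ² ⊗ ℂ²`; the basis vector `e_p ⊗ e_q` has index `(p, q)`, so that in the
order `(0,0), (0,1), (1,0), (1,1)` its rows are `(a,0,0,0)`, `(0,b,c,0)`, `(0,c,b,0)`, `(0,0,0,a)`. -/
noncomputable def rMatrix (γ x : ℂ) : Matrix (Fin 2 × Fin 2) (Fin 2 × Fin 2) ℂ :=
  fun s t =>
    if s = t then (if s.1 = s.2 then wa γ x else wb x)
    else if s.1 = t.2 ∧ s.2 = t.1 then wc γ else 0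

/-- Operators on `V₁ ⊗ ⋯ ⊗ V_L` with `V_j = ℂ²`, as matrices in the product basis: the basis vector
`e_{s 1} ⊗ ⋯ ⊗ e_{s L}` has the index `s : Fin L → Fin 2`. -/
abbrev QuantumOp (L : ℕ) : Type := Matrix (Fin L → Fin 2) (Fin L → Fin 2) ℂ

/-- The operator `R_{aj}(x)` on `V_a ⊗ V₁ ⊗ ⋯ ⊗ V_L`, written as a `2 × 2` matrix in the auxiliary
space `V_a` whose entries are operators on `V₁ ⊗ ⋯ ⊗ V_L`; it acts as `R(x)` on `V_a ⊗ V_j` and as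
the identity on the other factors. -/
noncomputable def rLocal {L : ℕ} (γ x : ℂ) (j : Fin L) : Matrix (Fin 2) (Fin 2) (QuantumOp L) :=
  fun p q => fun s t =>
    if ∀ k, k ≠ j → s k = t k then rMatrix γ x (p, s j) (q, t j) else 0

/-- The monodromy matrix `R_{a1}(x - μ₁) R_{a2}(x - μ₂) ⋯ R_{aL}(x - μ_L)`. -/
noncomputable def monodromy {L : ℕ} (γ : ℂ) (μ : Fin L → ℂ) (x : ℂ) :
    Matrix (Fin 2) (Fin 2) (QuantumOp L) :=
  (List.ofFn fun j => rLocal γ (x - μ j) j).prod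

/-- The operator `B(x)`, the upper right entry of the monodromy matrix. -/
noncomputable def opB {L : ℕ} (γ : ℂ) (μ : Fin L → ℂ) (x : ℂ) : QuantumOp L :=
  monodromy γ μ x 0 1

/-- The operator `C(x)`, the lower left entry of the monodromy matrix. -/
noncomputable def opC {L : ℕ} (γ : ℂ) (μ : Fin L → ℂ) (x : ℂ) : QuantumOp L :=
  monodromy γ μ x 1 0

/-- The vector `|0⟩ = e₀ ⊗ ⋯ ⊗ e₀`. -/
def vacuum (L : ℕ) : (Fin L → Fin 2) → ℂ := Pi.single (fun _ => 0) 1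

/-- The scalar product
`S_n(x₁, …, x_n | y₁, …, y_n) = ⟨0| C(x₁) ⋯ C(x_n) B(y₁) ⋯ B(y_n) |0⟩`. -/
noncomputable def scalarProduct {L n : ℕ} (γ : ℂ) (μ : Fin L → ℂ) (x y : Fin n → ℂ) : ℂ :=
  vacuum L ⬝ᵥ
    (((List.ofFn fun i => opC γ μ (x i)).prod * (List.ofFn fun i => opB γ μ (y i)).prod).mulVec
      (vacuum L))

/-- The Bethe ansatz equations with twist `φ₂ / φ₁` for `y₁, …, y_n`, all of whose denominators are
required not to vanish. -/
structure BetheEquations {L n : ℕ} (γ φ₁ φ₂ : ℂ) (μ : Fin L → ℂ) (y : Fin n → ℂ) : Prop where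
  twist_ne_zero : φ₁ ≠ 0
  b_ne_zero : ∀ i j, wb (y i - μ j) ≠ 0
  a_ne_zero : ∀ i k, k ≠ i → wa γ (y k - y i) ≠ 0
  equation : ∀ i,
    ∏ j, wa γ (y i - μ j) / wb (y i - μ j) =
      (-1) ^ (n - 1) * (φ₂ / φ₁) *
        ∏ k ∈ Finset.univ.erase i, wa γ (y i - y k) / wa γ (y k - y i)

/-! ## The kernel of the integral formula

Throughout, `w = (w₁, …, w_n)`, `v = (w̄₁, …, w̄_n)`, and for `h : n ≤ L` the number `μ_i` with
`i ≤ n` is `μ (Fin.castLE h i)`. -/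

section Kernel

variable {L n : ℕ} (h : n ≤ L) (γ φ₁ φ₂ : ℂ) (μ : Fin L → ℂ)

/-- `R_i = ∏_{k=i}^n a(w_k - μ_i)/b(w_k - μ_i) - ∏_{k=i}^n a(w̄_k - μ_i)/b(w̄_k - μ_i)`. -/
noncomputable def factorR (w v : Fin n → ℂ) (i : Fin n) : ℂ :=
  ∏ k ∈ Finset.Ici i, wa γ (w k - μ (Fin.castLE h i)) / wb (w k - μ (Fin.castLE h i)) -
    ∏ k ∈ Finset.Ici i, wa γ (v k - μ (Fin.castLE h i)) / wb (v k - μ (Fin.castLE h i))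

/-- The numerator of `R_i`, that is `R_i` times `∏_{k=i}^n b(w_k - μ_i) b(w̄_k - μ_i)`. -/
noncomputable def numeratorR (w v : Fin n → ℂ) (i : Fin n) : ℂ :=
  ∏ k ∈ Finset.Ici i, wa γ (w k - μ (Fin.castLE h i)) * wb (v k - μ (Fin.castLE h i)) -
    ∏ k ∈ Finset.Ici i, wa γ (v k - μ (Fin.castLE h i)) * wb (w k - μ (Fin.castLE h i))

/-- The twist-dependent factor `Λ_i^{ON}`. -/
noncomputable def lambdaON (w v : Fin n → ℂ) (i : Fin n) : ℂ :=
  (-1) ^ n / (∏ k ∈ Finset.Iio (Fin.castLE h i), wb (v i - μ k)) *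
      (∏ k ∈ Finset.Ici (Fin.castLE h i), wa γ (w i - μ k)) *
      (∏ k ∈ Finset.Ioi i, wa γ (w k - w i)) +
    φ₂ * φ₁⁻¹ / (∏ k ∈ Finset.Iio (Fin.castLE h i), wa γ (v i - μ k)) *
      (∏ k ∈ Finset.Ici (Fin.castLE h i), wb (w i - μ k)) *
      (∏ k ∈ Finset.Ioi i, wa γ (w i - w k)) *
      (∏ k ∈ Finset.Iio i, wa γ (v i - v k) / wa γ (v k - v i))

/-- The on-shell kernel `H(w₁, …, w_n | w̄₁, …, w̄_n)`. -/
noncomputable def kernelON (w v : Fin n → ℂ) : ℂ :=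
  (-1) ^ (n * (n + 1) / 2) * wc γ ^ (2 * n) *
    (((∏ i, ∏ j, wb (v i - μ j)) *
        ∏ i, ∏ j ∈ Finset.Ioi i,
          wa γ (v i - v j) * wa γ (v j - μ (Fin.castLE h i)) * wb (v j - v i)) /
      ∏ i, wb (v i - μ (Fin.castLE h i))) *
    ((∏ i, ∏ j ∈ Finset.Ioi i, wa γ (w j - μ (Fin.castLE h i)) * wb (w j - w i)) /
      ∏ i, wb (w i - μ (Fin.castLE h i))) *
    ∏ i, (factorR h γ μ w v i)⁻¹ * lambdaON h γ φ₁ φ₂ μ w v i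

/-- The last term `H^{(n)}(w_n | w̄_n)` of the recursion; `s` is the last index. -/
noncomputable def recLast (w v : Fin n → ℂ) (s : Fin n) : ℂ :=
  (-1) ^ n * wc γ ^ 2 *
    ((∏ k, wb (v s - μ k)) / (wb (w s - μ (Fin.castLE h s)) * wb (v s - μ (Fin.castLE h s)))) *
    (factorR h γ μ w v s)⁻¹ * lambdaON h γ φ₁ φ₂ μ w v s

/-- The coefficient of `H^{(s+1)}` in the recursion for `H^{(s)}`. -/
noncomputable def recCoeff (w v : Fin n → ℂ) (s : Fin n) : ℂ :=
  ((-1) ^ L * (∏ k, wb (v s - μ k)) *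
      (∏ k ∈ Finset.Ioi s, wa γ (w k - μ (Fin.castLE h s)) * wb (w k - w s)) /
    (wb (w s - μ (Fin.castLE h s)) * wb (v s - μ (Fin.castLE h s)) *
      ∏ k ∈ Finset.Ioi (Fin.castLE h s),
        wa γ (μ (Fin.castLE h s) - μ k) * wa γ (μ k - μ (Fin.castLE h s)))) *
    (∏ k ∈ Finset.Ioi s,
      wa γ (v s - v k) * wa γ (v k - μ (Fin.castLE h s)) * wb (v k - v s)) *
    (factorR h γ μ w v s)⁻¹ * lambdaON h γ φ₁ φ₂ μ w v s

/-- The functions `H^{(s)}`, from `H^{(n)}` downwards. The index `s` counts from `0`, so `H^{(1)}` is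
`kernelRec 0`. -/
noncomputable def kernelRec (w v : Fin n → ℂ) (s : ℕ) (hs : s < n) : ℂ :=
  if hs' : s + 1 < n then
    recCoeff h γ φ₁ φ₂ μ w v ⟨s, hs⟩ * kernelRec w v (s + 1) hs'
  else recLast h γ φ₁ φ₂ μ w v ⟨s, hs⟩
termination_by n - s

/-- The normalisation
`(-1)^{(n-1)L + n(n-1)/2} c^{2(n-1)} ∏_{s=1}^{n-1} ∏_{k=s+1}^L a(μ_s - μ_k) a(μ_k - μ_s)`
relating the kernel to the recursion. -/
noncomputable def recNorm : ℂ :=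
  (-1) ^ ((n - 1) * L + n * (n - 1) / 2) * wc γ ^ (2 * (n - 1)) *
    ∏ s ∈ Finset.univ.filter (fun s : Fin n => (s : ℕ) + 1 < n),
      ∏ k ∈ Finset.Ioi (Fin.castLE h s),
        wa γ (μ (Fin.castLE h s) - μ k) * wa γ (μ k - μ (Fin.castLE h s))

/-- None of the denominators in the formula for `H` vanishes at `(w, v)`, except possibly `R_i`. -/
structure RegularAt (w v : Fin n → ℂ) : Prop where
  w_mu : ∀ i k, i ≤ k → wb (w k - μ (Fin.castLE h i)) ≠ 0
  v_mu : ∀ i k, i ≤ k → wb (v k - μ (Fin.castLE h i)) ≠ 0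
  v_mu' : ∀ i k, k < i → wa γ (v i - μ (Fin.castLE h k)) ≠ 0
  v_v : ∀ i k, k < i → wa γ (v k - v i) ≠ 0

end Kernel

/-! ## Contours -/

/-- A contour is a finite union of positively oriented circles, each given by its centre and its
radius. This is the set of its points. -/
def curve (Γ : Finset (ℂ × ℝ)) : Set ℂ := ⋃ d ∈ Γ, Metric.sphere d.1 d.2

/-- The closed region bounded by a contour. -/
def region (Γ : Finset (ℂ × ℝ)) : Set ℂ := ⋃ d ∈ Γ, Metric.closedBall d.1 d.2

/-- The contour `Γ` consists of boundaries of disjoint discs, encloses each of the points `p_j`, and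
neither meets nor encloses any zero of `∏_j b(z - p_j)` other than the points `p_j` themselves. -/
structure Encloses {n : ℕ} (Γ : Finset (ℂ × ℝ)) (p : Fin n → ℂ) : Prop where
  radius_pos : ∀ d ∈ Γ, 0 < d.2
  disjoint : (Γ : Set (ℂ × ℝ)).PairwiseDisjoint fun d => Metric.closedBall d.1 d.2
  mem : ∀ j, ∃ d ∈ Γ, p j ∈ Metric.ball d.1 d.2
  solely : ∀ z ∈ region Γ, ∀ j, wb (z - p j) = 0 → z = p j

/-- The `n`-fold contour integral `∮ ⋯ ∮ f(w₁, …, w_n) ∏ dw_i / (2πi)`, each `w_i` running over all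
circles of `Γ`. -/
noncomputable def contourIntegral {n : ℕ} (Γ : Finset (ℂ × ℝ)) (f : (Fin n → ℂ) → ℂ) : ℂ :=
  (∑ d : Fin n → Γ, ∯ w in T(fun i => (d i).1.1, fun i => (d i).1.2), f w) /
    (2 * (Real.pi : ℂ) * I) ^ n

end SixVertex

/-!
Attach one site with inhomogeneity `ν` to a chain, at its left or at its right end. By
the RTT relation, the monodromy matrix `T ν` of the chain, read as a block matrix on the new site,
intertwines the two extended chains. As `⟨0|` and `|0⟩` are eigenvectors of `A ν`, the two
extended scalar products agree where the eigenvalue of `A ν` does not vanish, hence for every `ν`.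
Splitting off the spin of the new site and moving `A` or `D` to the vacuum expands each of them in
scalar products of the shorter chain with one `x_i` and one `y_k` removed. The scalar product
itself is left over on the two sides with different coefficients, whose difference is the
numerator of `R_1`, so it is determined by a recursion in `n`, which is solved by a double sum
over permutations of `x` and `y` of an off-shell kernel.

The Bethe equations turn the off-shell kernel into `H`, with its removable singularities removed,
and the double sum is then the sum of the residues of the integrand: the only poles are the simple
ones at the `x_j` and `y_j`, and the kernel vanishes when two of its arguments coincide. This
needs distinct `x_j`; the general case follows, since both sides are continuous in `x` and tuples
of distinct points are dense.
-/

namespace SixVertex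

open Matrix
open scoped Kronecker

/-! ### The Yang–Baxter algebra -/

section RTT

variable {𝒜 ℬ : Type*} [Ring 𝒜] [Algebra ℂ 𝒜] [Ring ℬ] [Algebra ℂ ℬ] {γ : ℂ}

/-- The relation `R₁₂(x - y) T₁(x) T₂(y) = T₂(y) T₁(x) R₁₂(x - y)` for a family `T` of `2 × 2`
matrices over an algebra. The indices in `Fin 2 × Fin 2` are those of the two auxiliary spaces, and
since the entries need not commute, `T₂(y) T₁(x)` is the Kronecker product with the entries
multiplied in the opposite order. -/
def SatisfiesRTT (γ : ℂ) (T : ℂ → Matrix (Fin 2) (Fin 2) 𝒜) : Prop :=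
  ∀ x y, (rMatrix γ (x - y)).map (algebraMap ℂ 𝒜) * (T x ⊗ₖ T y) =
    kroneckerMap (fun a b => b * a) (T x) (T y) * (rMatrix γ (x - y)).map (algebraMap ℂ 𝒜)

lemma SatisfiesRTT.mul {U V : ℂ → Matrix (Fin 2) (Fin 2) 𝒜} (hU : SatisfiesRTT γ U)
    (hV : SatisfiesRTT γ V) (hUV : ∀ x y p q r s, Commute (U x p q) (V y r s)) :
    SatisfiesRTT γ fun x => U x * V x := by
  intro x y
  have kronecker_mul : (U x * V x) ⊗ₖ (U y * V y) = (U x ⊗ₖ U y) * (V x ⊗ₖ V y) := by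
    ext s t
    simp only [kroneckerMap_apply, Matrix.mul_apply, Fintype.sum_prod_type, Finset.sum_mul_sum]
    refine Finset.sum_congr rfl fun i _ => Finset.sum_congr rfl fun j _ => ?_
    exact (hUV y x s.2 j i t.1).symm.mul_mul_mul_comm _ _
  have kroneckerOp_mul : kroneckerMap (fun a b => b * a) (U x * V x) (U y * V y) =
      kroneckerMap (fun a b => b * a) (U x) (U y) *
        kroneckerMap (fun a b => b * a) (V x) (V y) := by
    ext s t
    simp only [kroneckerMap_apply, Matrix.mul_apply, Fintype.sum_prod_type, Finset.sum_mul_sum]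
    rw [Finset.sum_comm]
    refine Finset.sum_congr rfl fun i _ => Finset.sum_congr rfl fun j _ => ?_
    exact (hUV x y s.1 i j t.2).symm.mul_mul_mul_comm _ _
  rw [kronecker_mul, kroneckerOp_mul, ← mul_assoc, hU x y, mul_assoc, hV x y, mul_assoc]

lemma SatisfiesRTT.map {T : ℂ → Matrix (Fin 2) (Fin 2) 𝒜} (hT : SatisfiesRTT γ T)
    (f : 𝒜 →ₐ[ℂ] ℬ) : SatisfiesRTT γ fun x => (T x).map f := by
  intro x y
  have map_rMatrix : f.mapMatrix ((rMatrix γ (x - y)).map (algebraMap ℂ 𝒜)) =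
      (rMatrix γ (x - y)).map (algebraMap ℂ ℬ) := by
    ext s t; simp
  have map_kronecker : f.mapMatrix (T x ⊗ₖ T y) = (T x).map f ⊗ₖ (T y).map f := by
    ext s t; simp
  have map_kroneckerOp : f.mapMatrix (kroneckerMap (fun a b => b * a) (T x) (T y)) =
      kroneckerMap (fun a b => b * a) ((T x).map f) ((T y).map f) := by
    ext s t; simp
  simpa only [map_mul, map_rMatrix, map_kronecker, map_kroneckerOp] using
    congrArg f.mapMatrix (hT x y)

lemma SatisfiesRTT.of_map {T : ℂ → Matrix (Fin 2) (Fin 2) 𝒜} (e : 𝒜 ≃ₐ[ℂ] ℬ)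
    (hT : SatisfiesRTT γ fun x => (T x).map e) : SatisfiesRTT γ T := by
  have h := SatisfiesRTT.map hT (e.symm : ℬ →ₐ[ℂ] 𝒜)
  have map_symm : (fun x => ((T x).map e).map (e.symm : ℬ →ₐ[ℂ] 𝒜)) = T := by
    funext x; ext p q; simp
  rwa [map_symm] at h

lemma SatisfiesRTT.apply {T : ℂ → Matrix (Fin 2) (Fin 2) 𝒜} (hT : SatisfiesRTT γ T)
    (x y : ℂ) (p q r s : Fin 2) :
    ∑ i, ∑ j, rMatrix γ (x - y) (p, q) (i, j) • (T x i r * T y j s) =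
      ∑ i, ∑ j, rMatrix γ (x - y) (i, j) (r, s) • (T y q j * T x p i) := by
  have h := congrFun (congrFun (hT x y) (p, q)) (r, s)
  simpa only [Matrix.mul_apply, Fintype.sum_prod_type, kroneckerMap_apply, Matrix.map_apply,
    ← Algebra.commutes, ← Algebra.smul_def] using h

/-- The matrix `R(x)` as a `2 × 2` matrix in the first space with entries acting on the second one:
the monodromy matrix of a single site. -/
noncomputable def siteOp (γ x : ℂ) : Matrix (Fin 2) (Fin 2) (Matrix (Fin 2) (Fin 2) ℂ) :=
  fun p q => fun s t => rMatrix γ x (p, s) (q, t)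

lemma wa_sub_mul_wb_mul_wc (γ x y : ℂ) :
    wa γ (x - y) * wb x * wc γ = wb (x - y) * wa γ x * wc γ + wb y * wc γ ^ 2 := by
  simp only [wa, wb, wc, sinh_add, sinh_sub, cosh_sub]
  linear_combination sinh γ ^ 2 * sinh y * cosh_sq x

lemma wa_sub_mul_wa_mul_wc (γ x y : ℂ) :
    wa γ (x - y) * wa γ y * wc γ = wb (x - y) * wb y * wc γ + wa γ x * wc γ ^ 2 := by
  simp only [wa, wb, wc, sinh_add, sinh_sub, cosh_sub]
  linear_combination sinh γ * sinh y * (sinh x * cosh y - cosh x * sinh y) * cosh_sq γ +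
    sinh γ ^ 2 * (sinh x * cosh γ + cosh x * sinh γ) * cosh_sq y

lemma wa_mul_wb_mul_wc (γ x y : ℂ) :
    wa γ y * wb x * wc γ = wa γ x * wb y * wc γ + wb (x - y) * wc γ ^ 2 := by
  simp only [wa, wb, wc, sinh_add, sinh_sub]
  ring

lemma yangBaxter (γ x y : ℂ) (p q r s a b : Fin 2) :
    ∑ i, ∑ j, rMatrix γ (x - y) (p, q) (i, j) *
        ∑ m, rMatrix γ x (i, a) (r, m) * rMatrix γ y (j, m) (s, b) =
      ∑ i, ∑ j, rMatrix γ (x - y) (i, j) (r, s) *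
        ∑ m, rMatrix γ y (q, a) (j, m) * rMatrix γ x (p, m) (i, b) := by
  have h₁ := wa_sub_mul_wb_mul_wc γ x y
  have h₂ := wa_sub_mul_wa_mul_wc γ x y
  have h₃ := wa_mul_wb_mul_wc γ x y
  revert p q r s a b
  simp only [Fin.forall_fin_two, Fin.sum_univ_two]
  simp only [rMatrix, Prod.mk.injEq, zero_ne_one, one_ne_zero, and_true, true_and, and_false,
    and_self, if_true, if_false, mul_zero, zero_mul, add_zero, zero_add]
  grind

lemma satisfiesRTT_siteOp (γ ν : ℂ) : SatisfiesRTT γ fun x => siteOp γ (x - ν) := by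
  intro x y
  ext ⟨p, q⟩ ⟨r, s⟩ a b
  simpa [Matrix.mul_apply, Fintype.sum_prod_type, siteOp, Algebra.algebraMap_eq_smul_one,
    Matrix.sum_apply] using yangBaxter γ (x - ν) (y - ν) p q r s a b

/-- The factor `a(x - y) / b(x - y)` of the exchange relations. -/
noncomputable def exch (γ x y : ℂ) : ℂ := wa γ (x - y) / wb (x - y)

lemma wb_sub_comm (x y : ℂ) : wb (x - y) = -wb (y - x) := by
  rw [wb, wb, ← sinh_neg, neg_sub]

lemma wa_sub_comm (γ x y : ℂ) : wa γ (x - y) = -wa (-γ) (y - x) := by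
  rw [wa, wa, ← sinh_neg]; ring_nf

lemma wc_neg (γ : ℂ) : wc (-γ) = -wc γ := sinh_neg γ

lemma wb_sq (γ x : ℂ) : wb x ^ 2 = wa γ x * wa (-γ) x + wc γ ^ 2 := by
  simp only [wa, wb, wc, sinh_add, sinh_neg, cosh_neg]
  linear_combination sinh γ ^ 2 * cosh_sq x - sinh x ^ 2 * cosh_sq γ

variable {T : ℂ → Matrix (Fin 2) (Fin 2) 𝒜}

lemma SatisfiesRTT.C_mul_A (hT : SatisfiesRTT γ T) {x y : ℂ} (hxy : wb (x - y) ≠ 0) :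
    T x 1 0 * T y 0 0 =
      exch γ x y • (T y 0 0 * T x 1 0) - (wc γ / wb (x - y)) • (T x 0 0 * T y 1 0) := by
  have relation : wc γ • (T x 0 0 * T y 1 0) + wb (x - y) • (T x 1 0 * T y 0 0) =
      wa γ (x - y) • (T y 0 0 * T x 1 0) := by
    simpa [Fin.sum_univ_two, rMatrix] using hT.apply x y 1 0 0 0
  apply smul_right_injective 𝒜 hxy
  simp only [exch, smul_sub, smul_smul, mul_div_cancel₀ _ hxy]
  rw [← relation, add_sub_cancel_left]

/-- The `C`–`D` relation has the products `D C` and `C D` interchanged with respect to the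
`C`–`A` relation. Solving the relations for `(x, y)` and `(y, x)` puts it into the same form, with
`-γ` in place of `γ`. -/
lemma SatisfiesRTT.C_mul_D (hT : SatisfiesRTT γ T) {x y : ℂ} (hxy : wb (x - y) ≠ 0) :
    T x 1 0 * T y 1 1 =
      exch (-γ) x y • (T y 1 1 * T x 1 0) - (wc (-γ) / wb (x - y)) • (T x 1 1 * T y 1 0) := by
  have relation (x y : ℂ) : wa γ (x - y) • (T x 1 0 * T y 1 1) =
      wb (x - y) • (T y 1 1 * T x 1 0) + wc γ • (T y 1 0 * T x 1 1) := by
    simpa [Fin.sum_univ_two, rMatrix] using hT.apply x y 1 1 0 1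
  have relation_swap := relation y x
  rw [wb_sub_comm, wa_sub_comm] at relation_swap
  apply smul_right_injective 𝒜 (mul_ne_zero hxy hxy)
  simp only [exch, smul_sub, smul_smul, mul_assoc, mul_div_cancel₀ _ hxy]
  rw [← sq, wb_sq γ, wc_neg]
  linear_combination (norm := module) wa (-γ) (x - y) • relation x y - wc γ • relation_swap

lemma SatisfiesRTT.C_mul_C (hT : SatisfiesRTT γ T) (x y : ℂ) :
    wa γ (x - y) • (T x 1 0 * T y 1 0) = wa γ (x - y) • (T y 1 0 * T x 1 0) := by
  simpa [Fin.sum_univ_two, rMatrix] using hT.apply x y 1 1 0 0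

lemma rMatrix_symm (γ x : ℂ) (s t : Fin 2 × Fin 2) : rMatrix γ x s t = rMatrix γ x t s := by
  obtain rfl | hst := eq_or_ne s t
  · rfl
  · simp only [rMatrix, hst, hst.symm, if_false, eq_comm, and_comm]

lemma SatisfiesRTT.transpose_op (hT : SatisfiesRTT γ T) :
    SatisfiesRTT γ fun x => (T x)ᵀ.map MulOpposite.op := by
  intro x y
  ext ⟨p, q⟩ ⟨r, s⟩
  apply MulOpposite.unop_injective
  simpa [Matrix.mul_apply, Fintype.sum_prod_type, MulOpposite.algebraMap_apply,
    ← Algebra.commutes, ← Algebra.smul_def, rMatrix_symm γ _ (r, s),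
    rMatrix_symm γ _ _ (p, q)] using (hT.apply x y r s p q).symm

end RTT

section Continuity

lemma countable_sinh_add_eq_zero (c : ℂ) : {x : ℂ | sinh (x + c) = 0}.Countable := by
  refine (Set.countable_range fun k : ℤ => -(k * Real.pi * I) - c).mono fun x hx => ?_
  have sin_eq_zero : sin ((x + c) * I) = 0 := by rw [sin_mul_I, hx, zero_mul]
  obtain ⟨k, hk⟩ := sin_eq_zero_iff.1 sin_eq_zero
  refine ⟨k, ?_⟩
  linear_combination I * hk - (x + c) * I_mul_I

lemma dense_sinh_add_ne_zero {κ : Type*} [Countable κ] (c : κ → ℂ) :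
    Dense {x : ℂ | ∀ k, sinh (x + c k) ≠ 0} := by
  have dense_compl := (Set.countable_iUnion fun k => countable_sinh_add_eq_zero (c k)).dense_compl ℂ
  simpa only [Set.compl_iUnion, Set.compl_ofPred, ← Set.ofPred_forall] using dense_compl

variable {𝒜 : Type*} [Ring 𝒜] [Algebra ℂ 𝒜] [TopologicalSpace 𝒜] [ContinuousMul 𝒜] [T2Space 𝒜]
  {γ : ℂ} {T : ℂ → Matrix (Fin 2) (Fin 2) 𝒜}

lemma SatisfiesRTT.commute_C (hT : SatisfiesRTT γ T) (hc : Continuous T) (x y : ℂ) :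
    Commute (T x 1 0) (T y 1 0) := by
  have continuous_C : Continuous fun x => T x 1 0 := hc.matrix_elem 1 0
  have commute_of_ne (x : ℂ) (hx : ∀ _ : Unit, sinh (x + (-y + γ)) ≠ 0) :
      T x 1 0 * T y 1 0 = T y 1 0 * T x 1 0 := by
    have hxy : wa γ (x - y) ≠ 0 := by simpa only [wa, sub_eq_add_neg, add_assoc] using hx ()
    exact smul_right_injective 𝒜 hxy (hT.C_mul_C x y)
  exact congrFun ((continuous_C.mul continuous_const).ext_on (dense_sinh_add_ne_zero _)
    (continuous_const.mul continuous_C) commute_of_ne) x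

lemma SatisfiesRTT.commute_B (hT : SatisfiesRTT γ T) (hc : Continuous T) (x y : ℂ) :
    Commute (T x 0 1) (T y 0 1) :=
  (hT.transpose_op.commute_C
    (hc.matrix_transpose.matrix_map MulOpposite.continuous_op) x y).unop

end Continuity

section OrderedProduct

variable {α M N : Type*} [Monoid M] [Monoid N] {n : ℕ}

/-- The ordered product `C(x₁) ⋯ C(x_n)`. -/
def opProd (C : α → M) (x : Fin n → α) : M := (List.ofFn fun i => C (x i)).prod

variable (C : α → M)

@[simp] lemma opProd_zero (x : Fin 0 → α) : opProd C x = 1 := by simp [opProd]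

lemma opProd_succ (x : Fin (n + 1) → α) : opProd C x = C (x 0) * opProd C (Fin.tail x) := by
  simp [opProd, List.ofFn_succ, Fin.tail]

lemma map_opProd {F : Type*} [FunLike F M N] [MonoidHomClass F M N] (f : F) (x : Fin n → α) :
    f (opProd C x) = opProd (fun z => f (C z)) x := by
  simp [opProd, map_list_prod, List.map_ofFn, Function.comp_def]

lemma semiconjBy_opProd {C' : α → M} {t : M} (h : ∀ z, SemiconjBy t (C z) (C' z))
    (x : Fin n → α) : SemiconjBy t (opProd C x) (opProd C' x) := by
  induction n with
  | zero => simp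
  | succ n ih => rw [opProd_succ, opProd_succ]; exact (h _).mul_right (ih _)

variable {C} (hC : ∀ z z', Commute (C z) (C z'))
include hC

lemma commute_opProd (z : α) (x : Fin n → α) : Commute (C z) (opProd C x) :=
  semiconjBy_opProd C (hC z) x

lemma opProd_succ' (x : Fin (n + 1) → α) : opProd C x = opProd C (Fin.tail x) * C (x 0) := by
  rw [opProd_succ, (commute_opProd hC _ _).eq]

lemma map_opProd_of_map_mul_swap {f : M → N} (map_one : f 1 = 1)
    (map_mul : ∀ a b, f (a * b) = f b * f a) (x : Fin n → α) :
    f (opProd C x) = opProd (fun z => f (C z)) x := by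
  induction n with
  | zero => simpa only [opProd_zero] using map_one
  | succ n ih => rw [opProd_succ' hC, opProd_succ, map_mul, ih]

end OrderedProduct

section BetheBra

variable {ι : Type*} [Fintype ι] [DecidableEq ι] {n : ℕ}

/-- The components of `x` are distinct modulo the zeros of `b`, so that the exchange relations apply
to any two of them. -/
def Separated (x : Fin n → ℂ) : Prop := Pairwise fun i j => wb (x i - x j) ≠ 0

lemma Separated.tail {x : Fin (n + 1) → ℂ} (hx : Separated x) : Separated (Fin.tail x) :=
  hx.comp_of_injective (Fin.succ_injective n)

lemma Separated.removeNth {x : Fin (n + 1) → ℂ} (hx : Separated x) (i : Fin (n + 1)) :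
    Separated (i.removeNth x) :=
  hx.comp_of_injective Fin.succAbove_right_injective

lemma tail_removeNth_succ {α : Type*} (x : Fin (n + 2) → α) (i : Fin (n + 1)) :
    Fin.tail (i.succ.removeNth x) = i.removeNth (Fin.tail x) := by
  ext j; simp [Fin.tail, Fin.removeNth]

lemma prod_removeNth_succ {α M : Type*} [CommMonoid M] (f : α → M) (x : Fin (n + 2) → α)
    (i : Fin (n + 1)) :
    ∏ j, f (i.succ.removeNth x j) = f (x 0) * ∏ j, f (i.removeNth (Fin.tail x) j) := by
  rw [Fin.prod_univ_succ, ← tail_removeNth_succ]; rfl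

/-- The bra `⟨u| C(x₁) ⋯ C(x_n)`. -/
def bra (u : ι → ℂ) (C : ℂ → Matrix ι ι ℂ) (x : Fin n → ℂ) : ι → ℂ := u ᵥ* opProd C x

/-- The algebraic Bethe ansatz relations of a commuting family `C` and a family `A` of which `u` is
an eigenvector with eigenvalues `α`. A monodromy matrix provides them for its entries `C` and `A`
with the parameter `γ` and for `C` and `D` with the parameter `-γ`. -/
structure BetheBra (γ : ℂ) (C A : ℂ → Matrix ι ι ℂ) (u : ι → ℂ) (α : ℂ → ℂ) : Prop where
  commute : ∀ x y, Commute (C x) (C y)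
  exchange : ∀ {x y}, wb (x - y) ≠ 0 →
    C x * A y = exch γ x y • (A y * C x) - (wc γ / wb (x - y)) • (A x * C y)
  vecMul_eigen : ∀ x, u ᵥ* A x = α x • u

variable {γ : ℂ} {C A : ℂ → Matrix ι ι ℂ} {u : ι → ℂ} {α : ℂ → ℂ}

lemma exch_three_term {x y z : ℂ} (hxy : wb (x - y) ≠ 0) (hzx : wb (z - x) ≠ 0)
    (hzy : wb (z - y) ≠ 0) :
    exch γ z y * (wc γ / wb (x - y)) - wc γ / wb (z - y) * (wc γ / wb (x - z)) =
      wc γ / wb (x - y) * exch γ z x := by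
  have split : x - y = (z - y) - (z - x) := by ring
  rw [exch, exch, wb_sub_comm x z]
  generalize z - y = p at *
  generalize z - x = q at *
  field_simp
  rw [split]
  simp only [wa, wb, wc, sinh_sub, sinh_add]
  ring

lemma wa_sub_wb_mul_eq_wb_mul_exch {ν x z : ℂ} (hzx : wb (z - x) ≠ 0) :
    wa γ (z - ν) - wb (x - ν) * (wc γ / wb (x - z)) = wb (z - ν) * exch γ z x := by
  have split : x - ν = (z - ν) - (z - x) := by ring
  rw [exch, wb_sub_comm x z, split]
  generalize z - ν = p at *
  generalize z - x = q at *
  field_simp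
  simp only [wa, wb, wc, sinh_sub, sinh_add]
  ring

namespace BetheBra

variable (h : BetheBra γ C A u α)
include h

lemma bra_succ (x : Fin (n + 1) → ℂ) : bra u C x = bra u C (Fin.tail x) ᵥ* C (x 0) := by
  rw [bra, bra, opProd_succ' h.commute, vecMul_vecMul]

lemma bra_removeNth_succ (x : Fin (n + 2) → ℂ) (i : Fin (n + 1)) :
    bra u C (i.succ.removeNth x) = bra u C (i.removeNth (Fin.tail x)) ᵥ* C (x 0) := by
  rw [h.bra_succ, tail_removeNth_succ]; rfl

/-- `A(y)` is moved to the left through all the `C(x_i)`, exchanging its argument with one of them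
or not. By commutativity, the coefficient of the term with `x_i` may be computed by moving `C(x_i)`
to the right end first. -/
theorem bra_vecMul (x : Fin (n + 1) → ℂ) (y : ℂ) (hx : Separated x)
    (hy : ∀ i, wb (x i - y) ≠ 0) :
    bra u C x ᵥ* A y = (α y * ∏ j, exch γ (x j) y) • bra u C x -
      ∑ i, (wc γ / wb (x i - y) * α (x i) * ∏ j, exch γ (i.removeNth x j) (x i)) •
        (bra u C (i.removeNth x) ᵥ* C y) := by
  induction n generalizing y with
  | zero =>
    rw [h.bra_succ x, vecMul_vecMul, h.exchange (hy 0)]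
    simp [bra, vecMul_sub, vecMul_smul, ← vecMul_vecMul, h.vecMul_eigen, smul_vecMul, smul_smul,
      mul_comm]
  | succ n ih =>
    have move_y := ih (Fin.tail x) y hx.tail fun i => hy i.succ
    have move_x₀ := ih (Fin.tail x) (x 0) hx.tail fun i => hx (Fin.succ_ne_zero i)
    have move_first : bra u C x ᵥ* A y =
        exch γ (x 0) y • (bra u C (Fin.tail x) ᵥ* A y ᵥ* C (x 0)) -
          (wc γ / wb (x 0 - y)) • (bra u C (Fin.tail x) ᵥ* A (x 0) ᵥ* C y) := by
      rw [h.bra_succ, vecMul_vecMul, h.exchange (hy 0)]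
      simp only [vecMul_sub, vecMul_smul, vecMul_vecMul]
    have C_comm (i : Fin (n + 1)) : bra u C (i.removeNth (Fin.tail x)) ᵥ* C (x 0) ᵥ* C y =
        bra u C (i.removeNth (Fin.tail x)) ᵥ* C y ᵥ* C (x 0) := by
      rw [vecMul_vecMul, vecMul_vecMul, (h.commute _ _).eq]
    have prod_split (i : Fin (n + 1)) : ∏ j, exch γ (i.succ.removeNth x j) (x i.succ) =
        exch γ (x 0) (x i.succ) * ∏ j, exch γ (i.removeNth (Fin.tail x) j) (x i.succ) :=
      prod_removeNth_succ (fun z => exch γ z (x i.succ)) x i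
    have coeff (i : Fin (n + 1)) := exch_three_term (γ := γ) (hy i.succ)
      (hx (Fin.succ_ne_zero i).symm) (hy 0)
    rw [move_first, move_y, move_x₀, Fin.sum_univ_succ (n := n + 1),
      Fin.prod_univ_succ (n := n + 1), h.bra_succ x]
    simp only [Matrix.sub_vecMul, smul_vecMul, Matrix.sum_vecMul, C_comm, h.bra_removeNth_succ,
      Fin.removeNth_zero, prod_split, smul_sub, smul_smul, Finset.smul_sum, Fin.tail]
    rw [sub_sub, add_sub_left_comm, ← Finset.sum_sub_distrib]
    congr 2
    · ring
    · congr 1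
      ring
    · refine Finset.sum_congr rfl fun i _ => ?_
      rw [← sub_smul]
      congr 1
      linear_combination (α (x i.succ) * ∏ j, exch γ (i.removeNth (Fin.tail x) j) (x i.succ)) *
        coeff i

end BetheBra

section Extension

/-- The form of the operator `C` on a chain with one more site at the left or right end, as a block
matrix on the additional site, of inhomogeneity `ν`: triangular because a `C` lowers one spin. -/
noncomputable def extC (γ ν κ : ℂ) (C A : ℂ → Matrix ι ι ℂ) (x : ℂ) :
    Matrix (Fin 2) (Fin 2) (Matrix ι ι ℂ) :=
  !![wb (x - ν) • C x, κ • A x; 0, wa γ (x - ν) • C x]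

/-- The coefficient with which `C(x₁) ⋯ C(x_n)` on the extended chain flips the additional spin by
means of `x_i`, while the other `x_j` act on the original chain. -/
noncomputable def flipCoeff (γ ν : ℂ) (α : ℂ → ℂ) (x : Fin (n + 1) → ℂ) (i : Fin (n + 1)) : ℂ :=
  α (x i) * ∏ j, wb (i.removeNth x j - ν) * exch γ (i.removeNth x j) (x i)

lemma opProd_extC_one_zero (γ ν κ : ℂ) (C A : ℂ → Matrix ι ι ℂ) (x : Fin n → ℂ) :
    opProd (extC γ ν κ C A) x 1 0 = 0 := by
  induction n with
  | zero => simp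
  | succ n ih => simp [opProd_succ, Matrix.mul_apply, ih, extC]

lemma opProd_extC_zero_zero (γ ν κ : ℂ) (C A : ℂ → Matrix ι ι ℂ) (x : Fin n → ℂ) :
    opProd (extC γ ν κ C A) x 0 0 = (∏ j, wb (x j - ν)) • opProd C x := by
  induction n with
  | zero => simp
  | succ n ih =>
    simp [opProd_succ, Matrix.mul_apply, ih, opProd_extC_one_zero, extC, smul_smul,
      Fin.prod_univ_succ, Fin.tail, mul_comm]

lemma flipCoeff_zero (γ ν : ℂ) (α : ℂ → ℂ) (x : Fin (n + 1) → ℂ) :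
    flipCoeff γ ν α x 0 =
      α (x 0) * ((∏ j, wb (Fin.tail x j - ν)) * ∏ j, exch γ (Fin.tail x j) (x 0)) := by
  rw [flipCoeff, Fin.removeNth_zero, Finset.prod_mul_distrib]

lemma flipCoeff_succ (γ ν : ℂ) (α : ℂ → ℂ) (x : Fin (n + 2) → ℂ) (i : Fin (n + 1)) :
    flipCoeff γ ν α x i.succ =
      wb (x 0 - ν) * exch γ (x 0) (x i.succ) * flipCoeff γ ν α (Fin.tail x) i := by
  rw [flipCoeff, flipCoeff, prod_removeNth_succ (fun z => wb (z - ν) * exch γ z (x i.succ))]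
  exact mul_left_comm _ _ _

namespace BetheBra

variable (h : BetheBra γ C A u α)
include h

lemma vecMul_opProd_extC {ν κ : ℂ} (hext : ∀ x y, Commute (extC γ ν κ C A x) (extC γ ν κ C A y))
    (x : Fin (n + 1) → ℂ) (hx : Separated x) :
    u ᵥ* opProd (extC γ ν κ C A) x 0 1 =
      κ • ∑ i, flipCoeff γ ν α x i • bra u C (i.removeNth x) := by
  induction n with
  | zero => simp [opProd_succ, extC, flipCoeff, bra, vecMul_smul, h.vecMul_eigen]
  | succ n ih =>
    have x_ne (i : Fin (n + 1)) : wb (x i.succ - x 0) ≠ 0 := hx (Fin.succ_ne_zero i)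
    have move_A := h.bra_vecMul (Fin.tail x) (x 0) hx.tail x_ne
    have split_last : u ᵥ* opProd (extC γ ν κ C A) x 0 1 =
        (κ * ∏ j, wb (Fin.tail x j - ν)) • (bra u C (Fin.tail x) ᵥ* A (x 0)) +
          wa γ (x 0 - ν) • (u ᵥ* opProd (extC γ ν κ C A) (Fin.tail x) 0 1 ᵥ* C (x 0)) := by
      rw [opProd_succ' hext, Matrix.mul_apply, Fin.sum_univ_two, opProd_extC_zero_zero]
      simp [extC, bra, vecMul_add, vecMul_smul, smul_smul]
    rw [split_last, move_A, ih _ hx.tail, Fin.sum_univ_succ (n := n + 1), flipCoeff_zero]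
    simp only [h.bra_removeNth_succ, flipCoeff_succ, Fin.removeNth_zero, smul_vecMul,
      Matrix.sum_vecMul, smul_sub, smul_add, smul_smul, Finset.smul_sum]
    rw [sub_add_eq_add_sub, add_sub_assoc, ← Finset.sum_sub_distrib]
    congr 1
    · congr 1
      ring
    · refine Finset.sum_congr rfl fun i _ => ?_
      rw [← sub_smul]
      congr 1
      have x₀_ne : wb (x 0 - x i.succ) ≠ 0 := hx (Fin.succ_ne_zero i).symm
      have prod_split : ∏ j, wb (Fin.tail x j - ν) =
          wb (x i.succ - ν) * ∏ j, wb (i.removeNth (Fin.tail x) j - ν) :=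
        Fin.prod_univ_succAbove _ i
      have tail_apply : Fin.tail x i = x i.succ := rfl
      rw [prod_split, flipCoeff, Finset.prod_mul_distrib, tail_apply]
      linear_combination (κ * α (x i.succ) * (∏ j, wb (i.removeNth (Fin.tail x) j - ν)) *
        ∏ j, exch γ (i.removeNth (Fin.tail x) j) (x i.succ)) *
          wa_sub_wb_mul_eq_wb_mul_exch (γ := γ) (ν := ν) x₀_ne

lemma sum_vecMul_opProd_extC_dotProduct {γ₂ ν₁ ν₂ κ : ℂ} {C₂ A₂ : ℂ → Matrix ι ι ℂ} {δ : ℂ → ℂ}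
    (h₂ : BetheBra γ₂ C₂ A₂ u δ)
    (hext : ∀ x y, Commute (extC γ ν₁ κ C A x) (extC γ ν₁ κ C A y))
    (hext₂ : ∀ x y, Commute (extC γ₂ ν₂ κ C₂ A₂ x) (extC γ₂ ν₂ κ C₂ A₂ y))
    (x y : Fin (n + 1) → ℂ) (hx : Separated x) (hy : Separated y) :
    ∑ m, (u ᵥ* opProd (extC γ ν₁ κ C A) x 0 m) ⬝ᵥ (u ᵥ* opProd (extC γ₂ ν₂ κ C₂ A₂) y 0 m) =
      (∏ j, wb (x j - ν₁)) * (∏ j, wb (y j - ν₂)) * (bra u C x ⬝ᵥ bra u C₂ y) +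
        κ ^ 2 * ∑ i, ∑ k, flipCoeff γ ν₁ α x i * flipCoeff γ₂ ν₂ δ y k *
          (bra u C (i.removeNth x) ⬝ᵥ bra u C₂ (k.removeNth y)) := by
  rw [Fin.sum_univ_two, opProd_extC_zero_zero, opProd_extC_zero_zero,
    h.vecMul_opProd_extC hext x hx, h₂.vecMul_opProd_extC hext₂ y hy, vecMul_smul, vecMul_smul,
    ← bra, ← bra]
  simp only [smul_dotProduct, dotProduct_smul, sum_dotProduct, dotProduct_sum, smul_eq_mul,
    Finset.mul_sum]
  congr 1
  · ring
  · rw [Finset.sum_comm]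
    refine Finset.sum_congr rfl fun i _ => Finset.sum_congr rfl fun k _ => ?_
    ring

end BetheBra
end Extension
end BetheBra

section HighestWeight

variable {ι : Type*} {n : ℕ}

/-- The transpose of a `2 × 2` block matrix. For a monodromy matrix it exchanges the operators `C`
and `B`, which reduces statements on `B` to statements on `C`. -/
def blockTranspose (M : Matrix (Fin 2) (Fin 2) (Matrix ι ι ℂ)) :
    Matrix (Fin 2) (Fin 2) (Matrix ι ι ℂ) := Mᵀ.map transpose

variable [Fintype ι] [DecidableEq ι]

lemma blockTranspose_opProd {α : Type*} {B : α → Matrix (Fin 2) (Fin 2) (Matrix ι ι ℂ)}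
    (hB : ∀ z z', Commute (B z) (B z')) (y : Fin n → α) :
    blockTranspose (opProd B y) = opProd (fun z => blockTranspose (B z)) y := by
  refine map_opProd_of_map_mul_swap hB ?_ (fun M N => ?_) y
  · ext p q : 1
    simp [blockTranspose, Matrix.one_apply, apply_ite transpose]
  · ext p q : 1
    simp [blockTranspose, Matrix.mul_apply]

lemma SatisfiesRTT.blockTranspose {γ : ℂ} {T : ℂ → Matrix (Fin 2) (Fin 2) (Matrix ι ι ℂ)}
    (hT : SatisfiesRTT γ T) : SatisfiesRTT γ fun x => blockTranspose (T x) :=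
  hT.transpose_op.map (transposeAlgEquiv ι ℂ ℂ).symm.toAlgHom

/-- A family of monodromy matrices with a reference state `u`, an eigenvector of `A` and `D` with
eigenvalues `α` and `δ` that is annihilated by `C` from the left and by `B` from the right. -/
structure HighestWeight (γ : ℂ) (T : ℂ → Matrix (Fin 2) (Fin 2) (Matrix ι ι ℂ)) (u : ι → ℂ)
    (α δ : ℂ → ℂ) : Prop where
  satisfiesRTT : SatisfiesRTT γ T
  continuous : Continuous T
  vecMul_A : ∀ x, u ᵥ* T x 0 0 = α x • u
  vecMul_D : ∀ x, u ᵥ* T x 1 1 = δ x • u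
  vecMul_B : ∀ x, u ᵥ* T x 0 1 = 0
  A_mulVec : ∀ x, T x 0 0 *ᵥ u = α x • u
  D_mulVec : ∀ x, T x 1 1 *ᵥ u = δ x • u
  C_mulVec : ∀ x, T x 1 0 *ᵥ u = 0

/-- The scalar product `⟨u| C(x₁) ⋯ C(x_n) B(y₁) ⋯ B(y_n) |u⟩`. -/
def pairing (T : ℂ → Matrix (Fin 2) (Fin 2) (Matrix ι ι ℂ)) (u : ι → ℂ) (x y : Fin n → ℂ) : ℂ :=
  u ⬝ᵥ ((opProd (fun z => T z 1 0) x * opProd (fun z => T z 0 1) y) *ᵥ u)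

namespace HighestWeight

variable {γ : ℂ} {T : ℂ → Matrix (Fin 2) (Fin 2) (Matrix ι ι ℂ)} {u : ι → ℂ} {α δ : ℂ → ℂ}
  (hT : HighestWeight γ T u α δ)
include hT

lemma blockTranspose : HighestWeight γ (fun x => blockTranspose (T x)) u α δ where
  satisfiesRTT := hT.satisfiesRTT.blockTranspose
  continuous := hT.continuous.matrix_transpose.matrix_map continuous_id.matrix_transpose
  vecMul_A x := (vecMul_transpose _ _).trans (hT.A_mulVec x)
  vecMul_D x := (vecMul_transpose _ _).trans (hT.D_mulVec x)
  vecMul_B x := (vecMul_transpose _ _).trans (hT.C_mulVec x)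
  A_mulVec x := (mulVec_transpose _ _).trans (hT.vecMul_A x)
  D_mulVec x := (mulVec_transpose _ _).trans (hT.vecMul_D x)
  C_mulVec x := (mulVec_transpose _ _).trans (hT.vecMul_B x)

lemma betheBra_A : BetheBra γ (fun x => T x 1 0) (fun x => T x 0 0) u α where
  commute := hT.satisfiesRTT.commute_C hT.continuous
  exchange := hT.satisfiesRTT.C_mul_A
  vecMul_eigen := hT.vecMul_A

lemma betheBra_D : BetheBra (-γ) (fun x => T x 1 0) (fun x => T x 1 1) u δ where
  commute := hT.satisfiesRTT.commute_C hT.continuous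
  exchange := hT.satisfiesRTT.C_mul_D
  vecMul_eigen := hT.vecMul_D

lemma pairing_eq_dotProduct_bra (x y : Fin n → ℂ) : pairing T u x y =
    bra u (fun z => T z 1 0) x ⬝ᵥ bra u (fun z => SixVertex.blockTranspose (T z) 1 0) y := by
  have transpose_opProd : (opProd (fun z => T z 0 1) y)ᵀ = opProd (fun z => (T z 0 1)ᵀ) y :=
    map_opProd_of_map_mul_swap (hT.satisfiesRTT.commute_B hT.continuous) transpose_one
      transpose_mul y
  rw [pairing, ← mulVec_mulVec, dotProduct_mulVec, ← vecMul_transpose, transpose_opProd]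
  rfl

end HighestWeight
end HighestWeight

section ExtraSite

variable {ι : Type*} [Fintype ι] [DecidableEq ι] {n : ℕ}

/-- The `L`-operator of an additional site with inhomogeneity `ν`, acting trivially on the chain. -/
noncomputable def siteEmb (ι : Type*) [Fintype ι] [DecidableEq ι] (γ ν x : ℂ) :
    Matrix (Fin 2) (Fin 2) (Matrix (Fin 2) (Fin 2) (Matrix ι ι ℂ)) :=
  (siteOp γ (x - ν)).map (Algebra.ofId ℂ (Matrix ι ι ℂ)).mapMatrix

/-- The monodromy matrix of the chain, acting trivially on an additional site. -/
def chainEmb (T : ℂ → Matrix (Fin 2) (Fin 2) (Matrix ι ι ℂ)) (x : ℂ) :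
    Matrix (Fin 2) (Fin 2) (Matrix (Fin 2) (Fin 2) (Matrix ι ι ℂ)) :=
  (T x).map (Matrix.scalarAlgHom (Fin 2) ℂ)

/-- The monodromy matrix of the chain extended by a site on the left. Operators on the extended
chain are block matrices on the additional site. -/
noncomputable def consSite (γ ν : ℂ) (T : ℂ → Matrix (Fin 2) (Fin 2) (Matrix ι ι ℂ)) (x : ℂ) :
    Matrix (Fin 2) (Fin 2) (Matrix (Fin 2) (Fin 2) (Matrix ι ι ℂ)) :=
  siteEmb ι γ ν x * chainEmb T x

/-- The monodromy matrix of the chain extended by a site on the right. -/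
noncomputable def snocSite (γ ν : ℂ) (T : ℂ → Matrix (Fin 2) (Fin 2) (Matrix ι ι ℂ)) (x : ℂ) :
    Matrix (Fin 2) (Fin 2) (Matrix (Fin 2) (Fin 2) (Matrix ι ι ℂ)) :=
  chainEmb T x * siteEmb ι γ ν x

/-- The scalar product of the extended chain, whose reference state is `u` with the additional spin
in the state `0`. -/
def extPairing (U : ℂ → Matrix (Fin 2) (Fin 2) (Matrix (Fin 2) (Fin 2) (Matrix ι ι ℂ)))
    (u : ι → ℂ) (x y : Fin n → ℂ) : ℂ :=
  u ⬝ᵥ ((opProd (fun z => U z 1 0) x * opProd (fun z => U z 0 1) y) 0 0 *ᵥ u)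

section

variable (γ ν : ℂ) (T : ℂ → Matrix (Fin 2) (Fin 2) (Matrix ι ι ℂ))

lemma siteEmb_apply (x : ℂ) (p q s t : Fin 2) :
    siteEmb ι γ ν x p q s t = rMatrix γ (x - ν) (p, s) (q, t) • 1 := by
  simp [siteEmb, siteOp, Algebra.ofId_apply, Algebra.algebraMap_eq_smul_one]

lemma chainEmb_apply (x : ℂ) (p q s t : Fin 2) :
    chainEmb T x p q s t = if s = t then T x p q else 0 := by
  simp [chainEmb, Matrix.scalarAlgHom, Matrix.diagonal_apply]

lemma consSite_apply (x : ℂ) (p q s t : Fin 2) :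
    consSite γ ν T x p q s t = ∑ m, rMatrix γ (x - ν) (p, s) (m, t) • T x m q := by
  simp [consSite, Matrix.mul_apply, Matrix.sum_apply, siteEmb_apply, chainEmb_apply,
    -Fin.sum_univ_two, -Matrix.smul_apply]

lemma snocSite_apply (x : ℂ) (p q s t : Fin 2) :
    snocSite γ ν T x p q s t = ∑ m, rMatrix γ (x - ν) (m, s) (q, t) • T x p m := by
  simp [snocSite, Matrix.mul_apply, Matrix.sum_apply, siteEmb_apply, chainEmb_apply,
    -Fin.sum_univ_two, -Matrix.smul_apply]

lemma commute_siteEmb_chainEmb (x y : ℂ) (p q r s : Fin 2) :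
    Commute (siteEmb ι γ ν x p q) (chainEmb T y r s) := by
  refine Matrix.ext fun a b => ?_
  simp only [Matrix.mul_apply, siteEmb_apply, chainEmb_apply]
  simp [-Fin.sum_univ_two]

lemma wb_sub_sub (x : ℂ) : wb (x - (ν - γ)) = wa γ (x - ν) := by
  rw [wa, wb]; ring_nf

lemma wa_neg_sub_sub (x : ℂ) : wa (-γ) (x - (ν - γ)) = wb (x - ν) := by
  rw [wa, wb]; ring_nf

lemma consSite_one_zero (x : ℂ) : consSite γ ν T x 1 0 =
    extC γ ν (wc γ) (fun z => T z 1 0) (fun z => T z 0 0) x := by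
  ext p q : 1
  rw [consSite_apply, Fin.sum_univ_two]
  fin_cases p <;> fin_cases q <;> simp [rMatrix, extC]

lemma snocSite_one_zero (x : ℂ) : snocSite γ ν T x 1 0 =
    extC (-γ) (ν - γ) (wc γ) (fun z => T z 1 0) (fun z => T z 1 1) x := by
  ext p q : 1
  rw [snocSite_apply, Fin.sum_univ_two]
  fin_cases p <;> fin_cases q <;> simp [rMatrix, extC, wb_sub_sub, wa_neg_sub_sub]

lemma blockTranspose_consSite (x : ℂ) (p q : Fin 2) : blockTranspose (consSite γ ν T x p q) =
    snocSite γ ν (fun z => blockTranspose (T z)) x q p := by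
  ext s t : 1
  simp only [blockTranspose, Matrix.map_apply, Matrix.transpose_apply, consSite_apply,
    snocSite_apply, Matrix.transpose_sum, Matrix.transpose_smul, rMatrix_symm _ _ (p, t)]

lemma blockTranspose_snocSite (x : ℂ) (p q : Fin 2) : blockTranspose (snocSite γ ν T x p q) =
    consSite γ ν (fun z => blockTranspose (T z)) x q p := by
  ext s t : 1
  simp only [blockTranspose, Matrix.map_apply, Matrix.transpose_apply, consSite_apply,
    snocSite_apply, Matrix.transpose_sum, Matrix.transpose_smul, rMatrix_symm _ _ (q, s)]

lemma continuous_rMatrix (s t : Fin 2 × Fin 2) : Continuous fun x => rMatrix γ (x - ν) s t := by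
  unfold rMatrix wa wb wc
  split_ifs <;> fun_prop

variable {γ T}

lemma satisfiesRTT_consSite (hT : SatisfiesRTT γ T) : SatisfiesRTT γ (consSite γ ν T) :=
  ((satisfiesRTT_siteOp γ ν).map _).mul (hT.map _) (commute_siteEmb_chainEmb γ ν T)

lemma satisfiesRTT_snocSite (hT : SatisfiesRTT γ T) : SatisfiesRTT γ (snocSite γ ν T) :=
  (hT.map _).mul ((satisfiesRTT_siteOp γ ν).map _) fun x y p q r s =>
    (commute_siteEmb_chainEmb γ ν T y x r s p q).symm

lemma continuous_consSite (hT : Continuous T) : Continuous (consSite γ ν T) := by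
  refine continuous_matrix fun p q => continuous_matrix fun s t => ?_
  simp only [consSite_apply]
  exact continuous_finsetSum _ fun m _ => (continuous_rMatrix γ ν _ _).smul (hT.matrix_elem m q)

lemma continuous_snocSite (hT : Continuous T) : Continuous (snocSite γ ν T) := by
  refine continuous_matrix fun p q => continuous_matrix fun s t => ?_
  simp only [snocSite_apply]
  exact continuous_finsetSum _ fun m _ => (continuous_rMatrix γ ν _ _).smul (hT.matrix_elem p m)

/-- On the additional site, `T ν` is a block matrix that moves this site from the right end of the
chain to the left end: this is the relation `R T T = T T R` read with the second auxiliary space as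
the additional site. -/
lemma SatisfiesRTT.semiconjBy_snocSite_consSite (hT : SatisfiesRTT γ T) (x : ℂ) (p q : Fin 2) :
    SemiconjBy (T ν) (snocSite γ ν T x p q) (consSite γ ν T x p q) := by
  ext s t : 1
  have h := (hT.apply x ν p s q t).symm
  rw [Finset.sum_comm] at h
  simp only [Matrix.mul_apply, consSite_apply, snocSite_apply, Finset.sum_mul, Finset.mul_sum,
    smul_mul_assoc, mul_smul_comm]
  exact h.trans Finset.sum_comm

end

lemma extPairing_eq_sum {U : ℂ → Matrix (Fin 2) (Fin 2) (Matrix (Fin 2) (Fin 2) (Matrix ι ι ℂ))}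
    (hU : ∀ z z', Commute (U z 0 1) (U z' 0 1)) (u : ι → ℂ) (x y : Fin n → ℂ) :
    extPairing U u x y = ∑ m, (u ᵥ* opProd (fun z => U z 1 0) x 0 m) ⬝ᵥ
      (u ᵥ* opProd (fun z => blockTranspose (U z 0 1)) y 0 m) := by
  rw [extPairing, Matrix.mul_apply, Matrix.sum_mulVec, dotProduct_sum]
  refine Finset.sum_congr rfl fun m _ => ?_
  rw [← blockTranspose_opProd hU, ← mulVec_mulVec, dotProduct_mulVec, ← vecMul_transpose]
  rfl

/-- The coefficient of the scalar product without `x i` and `y k` in the expansion of the scalar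
product over the spin of an additional site on the left. For a site on the right, `x` and `y`
exchange their roles. -/
noncomputable def siteCoeff (γ ν : ℂ) (α δ : ℂ → ℂ) (x y : Fin (n + 1) → ℂ) (i k : Fin (n + 1)) :
    ℂ :=
  flipCoeff γ ν α x i * flipCoeff (-γ) (ν - γ) δ y k

namespace HighestWeight

variable {γ ν : ℂ} {T : ℂ → Matrix (Fin 2) (Fin 2) (Matrix ι ι ℂ)} {u : ι → ℂ} {α δ : ℂ → ℂ}
  (hT : HighestWeight γ T u α δ)
include hT

lemma extPairing_consSite (x y : Fin (n + 1) → ℂ) (hx : Separated x) (hy : Separated y) :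
    extPairing (consSite γ ν T) u x y =
      (∏ j, wb (x j - ν)) * (∏ j, wa γ (y j - ν)) * pairing T u x y +
        wc γ ^ 2 * ∑ i, ∑ k, siteCoeff γ ν α δ x y i k *
          pairing T u (i.removeNth x) (k.removeNth y) := by
  have hU := satisfiesRTT_consSite ν hT.satisfiesRTT
  have hV := satisfiesRTT_snocSite ν hT.blockTranspose.satisfiesRTT
  have continuous_U := continuous_consSite (γ := γ) ν hT.continuous
  have continuous_V := continuous_snocSite (γ := γ) ν hT.blockTranspose.continuous
  have h := hT.betheBra_A.sum_vecMul_opProd_extC_dotProduct (ν₁ := ν) (ν₂ := ν - γ) (κ := wc γ)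
    hT.blockTranspose.betheBra_D
    (by simpa only [consSite_one_zero] using hU.commute_C continuous_U)
    (by simpa only [snocSite_one_zero] using hV.commute_C continuous_V) x y hx hy
  rw [extPairing_eq_sum (hU.commute_B continuous_U)]
  simpa only [consSite_one_zero, blockTranspose_consSite, snocSite_one_zero, wb_sub_sub,
    ← hT.pairing_eq_dotProduct_bra, siteCoeff] using h

lemma extPairing_snocSite (x y : Fin (n + 1) → ℂ) (hx : Separated x) (hy : Separated y) :
    extPairing (snocSite γ ν T) u x y =
      (∏ j, wa γ (x j - ν)) * (∏ j, wb (y j - ν)) * pairing T u x y +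
        wc γ ^ 2 * ∑ i, ∑ k, siteCoeff γ ν α δ y x k i *
          pairing T u (i.removeNth x) (k.removeNth y) := by
  have hU := satisfiesRTT_snocSite ν hT.satisfiesRTT
  have hV := satisfiesRTT_consSite ν hT.blockTranspose.satisfiesRTT
  have continuous_U := continuous_snocSite (γ := γ) ν hT.continuous
  have continuous_V := continuous_consSite (γ := γ) ν hT.blockTranspose.continuous
  have h := hT.betheBra_D.sum_vecMul_opProd_extC_dotProduct (ν₁ := ν - γ) (ν₂ := ν) (κ := wc γ)
    hT.blockTranspose.betheBra_A
    (by simpa only [snocSite_one_zero] using hU.commute_C continuous_U)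
    (by simpa only [consSite_one_zero] using hV.commute_C continuous_V) x y hx hy
  rw [extPairing_eq_sum (hU.commute_B continuous_U)]
  simpa only [snocSite_one_zero, blockTranspose_snocSite, consSite_one_zero, wb_sub_sub,
    ← hT.pairing_eq_dotProduct_bra, siteCoeff, mul_comm (flipCoeff γ ν α _ _)] using h

lemma extPairing_consSite_eq_extPairing_snocSite (hν : α ν ≠ 0) (x y : Fin n → ℂ) :
    extPairing (consSite γ ν T) u x y = extPairing (snocSite γ ν T) u x y := by
  have semiconj := hT.satisfiesRTT.semiconjBy_snocSite_consSite ν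
  have h := (semiconjBy_opProd _ (semiconj · 1 0) x).mul_right
    (semiconjBy_opProd _ (semiconj · 0 1) y)
  rw [extPairing, extPairing]
  generalize opProd (fun z => consSite γ ν T z 1 0) x * opProd _ y = X at h ⊢
  generalize opProd (fun z => snocSite γ ν T z 1 0) x * opProd _ y = Y at h ⊢
  have dotProduct_left (M : Matrix (Fin 2) (Fin 2) (Matrix ι ι ℂ)) :
      u ⬝ᵥ ((T ν * M) 0 0 *ᵥ u) = α ν * u ⬝ᵥ (M 0 0 *ᵥ u) := by
    simp [Matrix.mul_apply, add_mulVec, ← mulVec_mulVec, dotProduct_mulVec u (T ν _ _),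
      hT.vecMul_A, hT.vecMul_B]
  have dotProduct_right (M : Matrix (Fin 2) (Fin 2) (Matrix ι ι ℂ)) :
      u ⬝ᵥ ((M * T ν) 0 0 *ᵥ u) = α ν * u ⬝ᵥ (M 0 0 *ᵥ u) := by
    simp [Matrix.mul_apply, add_mulVec, ← mulVec_mulVec, hT.A_mulVec, hT.C_mulVec, mulVec_smul]
  refine mul_left_cancel₀ hν ?_
  rw [← dotProduct_right, ← dotProduct_left, h.eq]

lemma pairing_eq_sum (hα : Dense {z | α z ≠ 0}) (x y : Fin (n + 1) → ℂ) (hx : Separated x)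
    (hy : Separated y) (ν : ℂ) :
    ((∏ j, wa γ (x j - ν)) * (∏ j, wb (y j - ν)) -
      (∏ j, wb (x j - ν)) * (∏ j, wa γ (y j - ν))) * pairing T u x y =
        wc γ ^ 2 * ∑ i, ∑ k, (siteCoeff γ ν α δ x y i k - siteCoeff γ ν α δ y x k i) *
          pairing T u (i.removeNth x) (k.removeNth y) := by
  revert ν
  refine congrFun (Continuous.ext_on hα ?_ ?_ fun ν hν => ?_)
  · unfold wa wb; fun_prop
  · unfold siteCoeff flipCoeff wb; fun_prop
  · have h := hT.extPairing_consSite_eq_extPairing_snocSite hν x y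
    rw [hT.extPairing_consSite x y hx hy, hT.extPairing_snocSite x y hx hy] at h
    simp only [sub_mul, Finset.sum_sub_distrib, mul_sub]
    linear_combination -h

end HighestWeight
end ExtraSite

section Chain

variable {L : ℕ}

/-- Operators on a chain of `L + 1` sites as block matrices of operators on the last `L` sites. -/
noncomputable def splitFirst (L : ℕ) :
    QuantumOp (L + 1) ≃ₐ[ℂ] Matrix (Fin 2) (Fin 2) (QuantumOp L) :=
  (reindexAlgEquiv ℂ ℂ (Fin.consEquiv fun _ => Fin 2).symm).trans
    (compAlgEquiv (Fin 2) (Fin L → Fin 2) ℂ ℂ).symm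

lemma splitFirst_apply (X : QuantumOp (L + 1)) (p q : Fin 2) (s t : Fin L → Fin 2) :
    splitFirst L X p q s t = X (Fin.cons p s) (Fin.cons q t) := rfl

lemma splitFirst_rLocal_zero (γ ν x : ℂ) (p q : Fin 2) :
    splitFirst L (rLocal γ (x - ν) 0 p q) = siteEmb (Fin L → Fin 2) γ ν x p q := by
  ext a b s t
  have eq_off_zero : (∀ k : Fin (L + 1), k ≠ 0 → (Fin.cons a s : Fin (L + 1) → Fin 2) k =
      (Fin.cons b t : Fin (L + 1) → Fin 2) k) ↔ s = t := by
    simp [Fin.forall_fin_succ, funext_iff]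
  simp only [splitFirst_apply, siteEmb_apply, rLocal, eq_off_zero]
  by_cases hst : s = t <;> simp [hst]

lemma splitFirst_rLocal_succ (γ z : ℂ) (j : Fin L) (p q : Fin 2) :
    splitFirst L (rLocal γ z j.succ p q) = Matrix.scalarAlgHom (Fin 2) ℂ (rLocal γ z j p q) := by
  ext a b s t
  have eq_off_succ : (∀ k : Fin (L + 1), k ≠ j.succ → (Fin.cons a s : Fin (L + 1) → Fin 2) k =
      (Fin.cons b t : Fin (L + 1) → Fin 2) k) ↔ (a = b ∧ ∀ k, k ≠ j → s k = t k) := by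
    simp [Fin.forall_fin_succ, (Fin.succ_ne_zero j).symm]
  simp only [splitFirst_apply, rLocal, eq_off_succ, Matrix.scalarAlgHom]
  by_cases hab : a = b <;> simp [rLocal, hab]

lemma map_splitFirst_monodromy (γ : ℂ) (μ : Fin (L + 1) → ℂ) (x : ℂ) :
    (monodromy γ μ x).map (splitFirst L) = consSite γ (μ 0) (monodromy γ (Fin.tail μ)) x := by
  change (splitFirst L).toAlgHom.mapMatrix _ =
    siteEmb _ γ (μ 0) x * (Matrix.scalarAlgHom (Fin 2) ℂ).mapMatrix _
  rw [monodromy, monodromy, map_list_prod, map_list_prod, List.map_ofFn, List.map_ofFn,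
    List.ofFn_succ, List.prod_cons]
  refine congrArg₂ (· * ·) ?_ (congrArg (List.prod <| List.ofFn ·) (funext fun j => ?_))
  · ext p q : 1
    exact splitFirst_rLocal_zero γ (μ 0) x p q
  · ext p q : 1
    exact splitFirst_rLocal_succ γ _ j p q

lemma monodromy_cons (γ : ℂ) (μ : Fin (L + 1) → ℂ) (x : ℂ) (p q a b : Fin 2)
    (s t : Fin L → Fin 2) : monodromy γ μ x p q (Fin.cons a s) (Fin.cons b t) =
      ∑ m, rMatrix γ (x - μ 0) (p, a) (m, b) * monodromy γ (Fin.tail μ) x m q s t := by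
  have h := congrFun₂ (map_splitFirst_monodromy γ μ x) p q
  rw [← splitFirst_apply (monodromy γ μ x p q), ← Matrix.map_apply (f := splitFirst L), h,
    consSite_apply, Matrix.sum_apply]
  rfl

lemma monodromy_of_isEmpty (γ : ℂ) (μ : Fin 0 → ℂ) : monodromy γ μ = 1 := by
  funext x; simp [monodromy]

lemma satisfiesRTT_one {𝒜 : Type*} [Ring 𝒜] [Algebra ℂ 𝒜] (γ : ℂ) :
    SatisfiesRTT γ (1 : ℂ → Matrix (Fin 2) (Fin 2) 𝒜) := by
  have kroneckerOp_one : kroneckerMap (fun a b => b * a) (1 : Matrix (Fin 2) (Fin 2) 𝒜)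
      (1 : Matrix (Fin 2) (Fin 2) 𝒜) = 1 :=
    kroneckerMap_one_one _ (fun _ => mul_zero _) (fun _ => zero_mul _) (one_mul _)
  intro x y
  rw [Pi.one_apply, Pi.one_apply, one_kronecker_one, kroneckerOp_one, mul_one, one_mul]

lemma satisfiesRTT_monodromy (γ : ℂ) (μ : Fin L → ℂ) : SatisfiesRTT γ (monodromy γ μ) := by
  induction L with
  | zero => rw [monodromy_of_isEmpty]; exact satisfiesRTT_one γ
  | succ L ih =>
    refine SatisfiesRTT.of_map (splitFirst L) ?_
    simpa only [map_splitFirst_monodromy] using satisfiesRTT_consSite _ (ih _)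

lemma continuous_monodromy (γ : ℂ) (μ : Fin L → ℂ) : Continuous (monodromy γ μ) := by
  induction L with
  | zero => rw [monodromy_of_isEmpty]; exact continuous_one
  | succ L ih =>
    refine continuous_matrix fun p q => continuous_matrix fun s t => ?_
    rw [← Fin.cons_self_tail s, ← Fin.cons_self_tail t]
    simp only [monodromy_cons]
    exact continuous_finsetSum _ fun m _ => (continuous_rMatrix γ _ _ _).mul
      (((ih (Fin.tail μ)).matrix_elem m q).matrix_elem _ _)

lemma cons_zero_zero : (Fin.cons 0 0 : Fin (L + 1) → Fin 2) = 0 := by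
  ext j; cases j using Fin.cases <;> simp

lemma vacuum_cons (p : Fin 2) (s : Fin L → Fin 2) :
    vacuum (L + 1) (Fin.cons p s) = if p = 0 then vacuum L s else 0 := by
  have cons_eq_zero : (Fin.cons p s : Fin (L + 1) → Fin 2) = (fun _ => 0) ↔
      p = 0 ∧ s = fun _ => 0 := by
    simp [funext_iff, Fin.forall_fin_succ]
  simp only [vacuum, Pi.single_apply, cons_eq_zero]
  by_cases hp : p = 0 <;> simp [hp]

lemma vacuum_vecMul (X : QuantumOp L) : vacuum L ᵥ* X = X 0 := by
  rw [vacuum, single_one_vecMul]; rfl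

lemma mulVec_vacuum (X : QuantumOp L) : X *ᵥ vacuum L = fun s => X s 0 := by
  rw [vacuum, mulVec_single_one]; rfl

lemma monodromy_zero_left (γ : ℂ) (μ : Fin L → ℂ) (x : ℂ) (t : Fin L → Fin 2) :
    monodromy γ μ x 0 0 0 t = (∏ j, wa γ (x - μ j)) * vacuum L t ∧
    monodromy γ μ x 1 1 0 t = (∏ j, wb (x - μ j)) * vacuum L t ∧
    monodromy γ μ x 0 1 0 t = 0 := by
  induction L with
  | zero =>
    obtain rfl : t = fun _ => 0 := Subsingleton.elim _ _
    rw [Subsingleton.elim (0 : Fin 0 → Fin 2) fun _ => 0]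
    simp [monodromy_of_isEmpty, vacuum]
  | succ L ih =>
    obtain ⟨h_A, h_D, h_B⟩ := ih (Fin.tail μ) (Fin.tail t)
    rw [← Fin.cons_self_tail t, ← cons_zero_zero]
    simp only [monodromy_cons, Fin.sum_univ_two, h_A, h_D, h_B, vacuum_cons, Fin.prod_univ_succ]
    generalize t 0 = a
    fin_cases a <;> simp [rMatrix, mul_assoc, Fin.tail]

lemma monodromy_zero_right (γ : ℂ) (μ : Fin L → ℂ) (x : ℂ) (s : Fin L → Fin 2) :
    monodromy γ μ x 0 0 s 0 = (∏ j, wa γ (x - μ j)) * vacuum L s ∧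
    monodromy γ μ x 1 1 s 0 = (∏ j, wb (x - μ j)) * vacuum L s ∧
    monodromy γ μ x 1 0 s 0 = 0 := by
  induction L with
  | zero =>
    obtain rfl : s = fun _ => 0 := Subsingleton.elim _ _
    rw [Subsingleton.elim (0 : Fin 0 → Fin 2) fun _ => 0]
    simp [monodromy_of_isEmpty, vacuum]
  | succ L ih =>
    obtain ⟨h_A, h_D, h_C⟩ := ih (Fin.tail μ) (Fin.tail s)
    rw [← Fin.cons_self_tail s, ← cons_zero_zero]
    simp only [monodromy_cons, Fin.sum_univ_two, h_A, h_D, h_C, vacuum_cons, Fin.prod_univ_succ]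
    generalize s 0 = a
    fin_cases a <;> simp [rMatrix, mul_assoc, Fin.tail]

lemma highestWeight_monodromy (γ : ℂ) (μ : Fin L → ℂ) :
    HighestWeight γ (monodromy γ μ) (vacuum L) (fun x => ∏ j, wa γ (x - μ j))
      fun x => ∏ j, wb (x - μ j) where
  satisfiesRTT := satisfiesRTT_monodromy γ μ
  continuous := continuous_monodromy γ μ
  vecMul_A x := by rw [vacuum_vecMul]; ext t; exact (monodromy_zero_left γ μ x t).1
  vecMul_D x := by rw [vacuum_vecMul]; ext t; exact (monodromy_zero_left γ μ x t).2.1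
  vecMul_B x := by rw [vacuum_vecMul]; ext t; exact (monodromy_zero_left γ μ x t).2.2
  A_mulVec x := by rw [mulVec_vacuum]; ext s; exact (monodromy_zero_right γ μ x s).1
  D_mulVec x := by rw [mulVec_vacuum]; ext s; exact (monodromy_zero_right γ μ x s).2.1
  C_mulVec x := by rw [mulVec_vacuum]; ext s; exact (monodromy_zero_right γ μ x s).2.2

lemma vacuum_dotProduct_mulVec (X : QuantumOp L) : vacuum L ⬝ᵥ (X *ᵥ vacuum L) = X 0 0 := by
  rw [mulVec_vacuum, vacuum, single_one_dotProduct]; rfl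

lemma scalarProduct_eq_pairing {n : ℕ} (γ : ℂ) (μ : Fin L → ℂ) (x y : Fin n → ℂ) :
    scalarProduct γ μ x y = pairing (monodromy γ μ) (vacuum L) x y := rfl

lemma scalarProduct_eq_extPairing {n : ℕ} (γ : ℂ) (μ : Fin (L + 1) → ℂ) (x y : Fin n → ℂ) :
    scalarProduct γ μ x y =
      extPairing (consSite γ (μ 0) (monodromy γ (Fin.tail μ))) (vacuum L) x y := by
  simp only [extPairing, ← map_splitFirst_monodromy, Matrix.map_apply]
  rw [← map_opProd, ← map_opProd, ← map_mul, vacuum_dotProduct_mulVec, splitFirst_apply,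
    scalarProduct_eq_pairing, pairing, vacuum_dotProduct_mulVec, cons_zero_zero]

end Chain

/-! ### The recursion for the scalar product -/

section Recursion

variable {L n : ℕ}

/-- The weight with which `A(x_i)`, moved past the other `C(x_j)`, acts on `⟨0|`. -/
noncomputable def weightA (γ : ℂ) (μ : Fin (L + 1) → ℂ) (x : Fin (n + 1) → ℂ)
    (i : Fin (n + 1)) : ℂ :=
  (∏ j, wa γ (x i - μ j)) * ∏ j, exch γ (i.removeNth x j) (x i)

/-- The weight with which `D(x_i)`, moved past the other `C(x_j)`, acts on `⟨0|`. -/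
noncomputable def weightD (γ : ℂ) (μ : Fin (L + 1) → ℂ) (x : Fin (n + 1) → ℂ)
    (i : Fin (n + 1)) : ℂ :=
  (∏ j, wb (x i - μ j)) * ∏ j, exch (-γ) (i.removeNth x j) (x i)

/-- The coefficient, up to `c ^ 2`, of the scalar product of the chain without its first site and
without the parameters `x_i` and `y_k` in the recursion for the scalar product. -/
noncomputable def recursionCoeff (γ : ℂ) (μ : Fin (L + 1) → ℂ) (x y : Fin (n + 1) → ℂ)
    (i k : Fin (n + 1)) : ℂ :=
  (∏ j, wa γ (i.removeNth x j - μ 0) * wb (i.removeNth x j - μ 0)) *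
    (∏ j, wa γ (k.removeNth y j - μ 0) * wb (k.removeNth y j - μ 0)) *
    (weightA γ μ x i * weightD γ μ y k - weightD γ μ x i * weightA γ μ y k)

lemma recursionCoeff_eq_siteCoeff (γ : ℂ) (μ : Fin (L + 1) → ℂ) (x y : Fin (n + 1) → ℂ)
    (i k : Fin (n + 1)) :
    recursionCoeff γ μ x y i k =
      (∏ j, wa γ (x j - μ 0)) * (∏ j, wb (y j - μ 0)) *
        siteCoeff γ (μ 0) (fun z => ∏ j, wa γ (z - Fin.tail μ j))
          (fun z => ∏ j, wb (z - Fin.tail μ j)) x y i k -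
      (∏ j, wb (x j - μ 0)) * (∏ j, wa γ (y j - μ 0)) *
        siteCoeff γ (μ 0) (fun z => ∏ j, wa γ (z - Fin.tail μ j))
          (fun z => ∏ j, wb (z - Fin.tail μ j)) y x k i := by
  simp only [recursionCoeff, weightA, weightD, siteCoeff, flipCoeff, Finset.prod_mul_distrib,
    wb_sub_sub, Fin.prod_univ_succ (n := L), Fin.tail]
  rw [Fin.prod_univ_succAbove (fun j => wa γ (x j - μ 0)) i,
    Fin.prod_univ_succAbove (fun j => wb (x j - μ 0)) i,
    Fin.prod_univ_succAbove (fun j => wa γ (y j - μ 0)) k,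
    Fin.prod_univ_succAbove (fun j => wb (y j - μ 0)) k]
  simp only [Fin.removeNth_apply]
  ring

lemma numeratorR_zero (h : n + 1 ≤ L + 1) (γ : ℂ) (μ : Fin (L + 1) → ℂ)
    (w v : Fin (n + 1) → ℂ) :
    numeratorR h γ μ w v 0 =
      (∏ j, wa γ (w j - μ 0)) * (∏ j, wb (v j - μ 0)) -
        (∏ j, wb (w j - μ 0)) * ∏ j, wa γ (v j - μ 0) := by
  rw [numeratorR, ← bot_eq_zero, Finset.Ici_bot, bot_eq_zero]
  simp only [Fin.castLE_zero, Finset.prod_mul_distrib]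
  ring

/-- Comparing the two ways of attaching the first site to the rest of the chain. -/
lemma numeratorR_mul_scalarProduct (h : n + 1 ≤ L + 1) (γ : ℂ) (μ : Fin (L + 1) → ℂ)
    {x y : Fin (n + 1) → ℂ} (hx : Separated x) (hy : Separated y) :
    numeratorR h γ μ x y 0 * scalarProduct γ μ x y =
      wc γ ^ 2 * ∑ i, ∑ k, recursionCoeff γ μ x y i k *
        scalarProduct γ (Fin.tail μ) (i.removeNth x) (k.removeNth y) := by
  have hT := highestWeight_monodromy γ (Fin.tail μ)
  have hdense : Dense {z | ∏ j, wa γ (z - Fin.tail μ j) ≠ 0} := by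
    refine (dense_sinh_add_ne_zero fun j => -Fin.tail μ j + γ).mono fun z hz => ?_
    exact Finset.prod_ne_zero_iff.2 fun j _ => by
      simpa only [wa, sub_eq_add_neg, add_assoc] using hz j
  have hfirst := hT.extPairing_consSite (ν := μ 0) x y hx hy
  have hrest := hT.pairing_eq_sum hdense x y hx hy (μ 0)
  simp only [← scalarProduct_eq_extPairing, ← scalarProduct_eq_pairing, mul_sub, sub_mul,
    Finset.sum_sub_distrib] at hfirst hrest
  simp only [numeratorR_zero, recursionCoeff_eq_siteCoeff, sub_mul, Finset.sum_sub_distrib,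
    mul_assoc, ← Finset.mul_sum, mul_sub]
  simp only [mul_assoc] at hfirst hrest
  rw [hfirst]
  linear_combination (∏ j, wb (x j - μ 0)) * (∏ j, wa γ (y j - μ 0)) * hrest

end Recursion

section RemoveNth

variable {n : ℕ} {M : Type*} [CommMonoid M]

lemma prod_erase_eq_prod_succAbove (f : Fin (n + 1) → M) (i : Fin (n + 1)) :
    ∏ j ∈ Finset.univ.erase i, f j = ∏ j, f (i.succAbove j) := by
  rw [← Finset.filter_ne', Finset.prod_filter, Fin.prod_univ_succAbove _ i]
  simp [Fin.succAbove_ne]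

lemma prod_erase_comp_perm (f : Fin n → M) (π : Equiv.Perm (Fin n)) (i : Fin n) :
    ∏ j ∈ Finset.univ.erase i, f (π j) = ∏ j ∈ Finset.univ.erase (π i), f j :=
  Finset.prod_equiv π (by simp) fun _ _ => rfl

lemma prod_removeNth_comp_perm {α : Type*} (f : α → M) (x : Fin (n + 1) → α)
    (π : Equiv.Perm (Fin (n + 1))) (i : Fin (n + 1)) :
    ∏ j, f (i.removeNth (x ∘ π) j) = ∏ j, f ((π i).removeNth x j) := by
  simp only [Fin.removeNth_apply]
  rw [← prod_erase_eq_prod_succAbove fun j => f ((x ∘ π) j),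
    ← prod_erase_eq_prod_succAbove fun j => f (x j)]
  exact prod_erase_comp_perm (fun j => f (x j)) π i

/-- The permutation with first value `i` whose other values are those of `σ`, transported along the
increasing enumeration of the complement of `i`. -/
def consPerm (i : Fin (n + 1)) (σ : Equiv.Perm (Fin n)) : Equiv.Perm (Fin (n + 1)) :=
  i.cycleRange.symm * Equiv.Perm.decomposeFin.symm (0, σ)

@[simp]
lemma consPerm_zero (i : Fin (n + 1)) (σ : Equiv.Perm (Fin n)) : consPerm i σ 0 = i := by
  simp [consPerm]

@[simp]
lemma consPerm_succ (i : Fin (n + 1)) (σ : Equiv.Perm (Fin n)) (j : Fin n) :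
    consPerm i σ j.succ = i.succAbove (σ j) := by
  simp [consPerm]

lemma tail_comp_consPerm {α : Type*} (x : Fin (n + 1) → α) (i : Fin (n + 1))
    (σ : Equiv.Perm (Fin n)) : Fin.tail (x ∘ consPerm i σ) = i.removeNth x ∘ σ := by
  ext j; simp [Fin.tail, Fin.removeNth]

lemma bijective_uncurry_consPerm :
    Function.Bijective (Function.uncurry (consPerm (n := n))) := by
  refine (Fintype.bijective_iff_injective_and_card _).2 ⟨?_, ?_⟩
  · rintro ⟨i, σ⟩ ⟨k, τ⟩ h
    obtain rfl : i = k := by simpa using Equiv.congr_fun h 0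
    have hσ : σ = τ := Equiv.ext fun j => by simpa using Equiv.congr_fun h j.succ
    rw [hσ]
  · simp [Fintype.card_perm, Nat.factorial_succ]

lemma sum_perm_succ {E : Type*} [AddCommMonoid E] (f : Equiv.Perm (Fin (n + 1)) → E) :
    ∑ π, f π = ∑ i, ∑ σ, f (consPerm i σ) := by
  rw [← Fintype.sum_prod_type' fun i σ => f (consPerm i σ)]
  exact (bijective_uncurry_consPerm.sum_comp f).symm

end RemoveNth

section SumFormula

variable {L n : ℕ}

/-- The numerator that takes the place of `Λ_i` when `v` does not satisfy the Bethe equations. -/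
noncomputable def offLambda (h : n ≤ L) (γ : ℂ) (μ : Fin L → ℂ) (w v : Fin n → ℂ) (i : Fin n) :
    ℂ :=
  (∏ k ∈ Finset.Ici (Fin.castLE h i), wa γ (w i - μ k) * wb (v i - μ k)) *
      (∏ k ∈ Finset.Ioi i, wa γ (w k - w i) * wa γ (v i - v k)) -
    (∏ k ∈ Finset.Ici (Fin.castLE h i), wb (w i - μ k) * wa γ (v i - μ k)) *
      (∏ k ∈ Finset.Ioi i, wa γ (w i - w k) * wa γ (v k - v i))

/-- The `i`-th factor of the off-shell kernel. -/
noncomputable def offLevel (h : n ≤ L) (γ : ℂ) (μ : Fin L → ℂ) (w v : Fin n → ℂ) (i : Fin n) : ℂ :=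
  wc γ ^ 2 *
    (∏ k ∈ Finset.Ioi i, wa γ (w k - μ (Fin.castLE h i)) * wb (w k - μ (Fin.castLE h i)) *
      (wa γ (v k - μ (Fin.castLE h i)) * wb (v k - μ (Fin.castLE h i)))) *
    (∏ k ∈ Finset.Ioi i, wb (w k - w i) * wb (v i - v k)) *
    (offLambda h γ μ w v i / numeratorR h γ μ w v i)

/-- The off-shell kernel: it plays the role of `H` when `v` does not satisfy the Bethe equations. -/
noncomputable def offKernel (h : n ≤ L) (γ : ℂ) (μ : Fin L → ℂ) (w v : Fin n → ℂ) : ℂ :=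
  ∏ i, offLevel h γ μ w v i

/-- The discriminant of `x` for the function `b` in place of the difference. -/
noncomputable def hypDiscr (x : Fin n → ℂ) : ℂ :=
  ∏ i, ∏ j ∈ Finset.univ.erase i, wb (x i - x j)

lemma Separated.hypDiscr_ne_zero {x : Fin n → ℂ} (hx : Separated x) : hypDiscr x ≠ 0 :=
  Finset.prod_ne_zero_iff.2 fun _ _ => Finset.prod_ne_zero_iff.2 fun _ hj =>
    hx (Finset.ne_of_mem_erase hj).symm

lemma Separated.comp_perm {x : Fin n → ℂ} (hx : Separated x) (π : Equiv.Perm (Fin n)) :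
    Separated (x ∘ π) :=
  hx.comp_of_injective π.injective

lemma hypDiscr_succAbove (x : Fin (n + 1) → ℂ) (i : Fin (n + 1)) :
    hypDiscr x = (∏ j, wb (x i - i.removeNth x j) * wb (i.removeNth x j - x i)) *
      hypDiscr (i.removeNth x) := by
  simp only [hypDiscr, ← Finset.filter_ne', Finset.prod_filter, Fin.prod_univ_succAbove _ i,
    Finset.prod_mul_distrib, Fin.removeNth_apply]
  simp [Fin.succAbove_ne, mul_assoc]

lemma numeratorR_succ (h : n + 1 ≤ L + 1) (γ : ℂ) (μ : Fin (L + 1) → ℂ) (w v : Fin (n + 1) → ℂ)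
    (i : Fin n) : numeratorR h γ μ w v i.succ =
      numeratorR (Nat.le_of_succ_le_succ h) γ (Fin.tail μ) (Fin.tail w) (Fin.tail v) i := by
  simp only [numeratorR, Fin.prod_Ici_succ, Fin.castLE_succ, Fin.tail]

lemma offLevel_succ (h : n + 1 ≤ L + 1) (γ : ℂ) (μ : Fin (L + 1) → ℂ) (w v : Fin (n + 1) → ℂ)
    (i : Fin n) : offLevel h γ μ w v i.succ =
      offLevel (Nat.le_of_succ_le_succ h) γ (Fin.tail μ) (Fin.tail w) (Fin.tail v) i := by
  simp only [offLevel, offLambda, Fin.prod_Ici_succ, Fin.prod_Ioi_succ, Fin.castLE_succ,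
    numeratorR_succ, Fin.tail]

lemma offKernel_succ (h : n + 1 ≤ L + 1) (γ : ℂ) (μ : Fin (L + 1) → ℂ) (w v : Fin (n + 1) → ℂ) :
    offKernel h γ μ w v = offLevel h γ μ w v 0 *
      offKernel (Nat.le_of_succ_le_succ h) γ (Fin.tail μ) (Fin.tail w) (Fin.tail v) := by
  simp only [offKernel, Fin.prod_univ_succ, offLevel_succ]

lemma exch_neg (γ x y : ℂ) : exch (-γ) x y = wa γ (y - x) / wb (y - x) := by
  rw [exch, wa_sub_comm, neg_neg, wb_sub_comm, neg_div_neg_eq]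

lemma offLevel_zero (h : n + 1 ≤ L + 1) (γ : ℂ) (μ : Fin (L + 1) → ℂ) {w v : Fin (n + 1) → ℂ}
    (hw : Separated w) (hv : Separated v) :
    offLevel h γ μ w v 0 = wc γ ^ 2 * recursionCoeff γ μ w v 0 0 / numeratorR h γ μ w v 0 *
      ((∏ j, wb (w 0 - Fin.tail w j) * wb (Fin.tail w j - w 0)) *
        ∏ j, wb (v 0 - Fin.tail v j) * wb (Fin.tail v j - v 0)) := by
  have hw0 : ∏ j, wb (Fin.tail w j - w 0) ≠ 0 :=
    Finset.prod_ne_zero_iff.2 fun j _ => hw (Fin.succ_ne_zero j)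
  have hv0 : ∏ j, wb (Fin.tail v j - v 0) ≠ 0 :=
    Finset.prod_ne_zero_iff.2 fun j _ => hv (Fin.succ_ne_zero j)
  have hsign : (-1 : ℂ) ^ n ≠ 0 := pow_ne_zero _ (by norm_num)
  have hsub : ∀ (x : Fin (n + 1) → ℂ), ∏ j : Fin n, wb (x 0 - x j.succ) =
      (-1) ^ n * ∏ j : Fin n, wb (x j.succ - x 0) := fun x => by
    simp only [wb_sub_comm (x 0), Finset.prod_neg, Finset.card_univ, Fintype.card_fin]
  have hIci : Finset.Ici (0 : Fin (L + 1)) = Finset.univ := by ext; simp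
  simp only [offLevel, offLambda, recursionCoeff, weightA, weightD, Fin.prod_Ioi_zero, hIci,
    Fin.castLE_zero, Finset.prod_mul_distrib, exch_neg, Fin.removeNth_zero, Fin.tail] at hw0 hv0 ⊢
  simp only [exch, Finset.prod_div_distrib, hsub]
  generalize ∏ j : Fin n, wb (w j.succ - w 0) = p at *
  generalize ∏ j : Fin n, wb (v j.succ - v 0) = q at *
  generalize (-1 : ℂ) ^ n = s at *
  field_simp

lemma weightA_comp_perm (γ : ℂ) (μ : Fin (L + 1) → ℂ) (x : Fin (n + 1) → ℂ)
    (π : Equiv.Perm (Fin (n + 1))) (i : Fin (n + 1)) :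
    weightA γ μ (x ∘ π) i = weightA γ μ x (π i) :=
  congrArg _ (prod_removeNth_comp_perm (fun z => exch γ z (x (π i))) x π i)

lemma weightD_comp_perm (γ : ℂ) (μ : Fin (L + 1) → ℂ) (x : Fin (n + 1) → ℂ)
    (π : Equiv.Perm (Fin (n + 1))) (i : Fin (n + 1)) :
    weightD γ μ (x ∘ π) i = weightD γ μ x (π i) :=
  congrArg _ (prod_removeNth_comp_perm (fun z => exch (-γ) z (x (π i))) x π i)

lemma recursionCoeff_comp_perm (γ : ℂ) (μ : Fin (L + 1) → ℂ) (x y : Fin (n + 1) → ℂ)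
    (π ρ : Equiv.Perm (Fin (n + 1))) (i k : Fin (n + 1)) :
    recursionCoeff γ μ (x ∘ π) (y ∘ ρ) i k = recursionCoeff γ μ x y (π i) (ρ k) := by
  rw [recursionCoeff, recursionCoeff, weightA_comp_perm, weightA_comp_perm, weightD_comp_perm,
    weightD_comp_perm, prod_removeNth_comp_perm fun z => wa γ (z - μ 0) * wb (z - μ 0),
    prod_removeNth_comp_perm fun z => wa γ (z - μ 0) * wb (z - μ 0)]

lemma numeratorR_zero_comp_perm (h : n + 1 ≤ L + 1) (γ : ℂ) (μ : Fin (L + 1) → ℂ)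
    (x y : Fin (n + 1) → ℂ) (π ρ : Equiv.Perm (Fin (n + 1))) :
    numeratorR h γ μ (x ∘ π) (y ∘ ρ) 0 = numeratorR h γ μ x y 0 := by
  simp only [numeratorR_zero, Function.comp_apply]
  rw [Equiv.prod_comp π fun j => wa γ (x j - μ 0), Equiv.prod_comp π fun j => wb (x j - μ 0),
    Equiv.prod_comp ρ fun j => wa γ (y j - μ 0), Equiv.prod_comp ρ fun j => wb (y j - μ 0)]

lemma offKernel_comp_consPerm (h : n + 1 ≤ L + 1) (γ : ℂ) (μ : Fin (L + 1) → ℂ)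
    {x y : Fin (n + 1) → ℂ} (hx : Separated x) (hy : Separated y) (i k : Fin (n + 1))
    (σ τ : Equiv.Perm (Fin n)) :
    offKernel h γ μ (x ∘ consPerm i σ) (y ∘ consPerm k τ) =
      wc γ ^ 2 * recursionCoeff γ μ x y i k / numeratorR h γ μ x y 0 *
        ((∏ j, wb (x i - i.removeNth x j) * wb (i.removeNth x j - x i)) *
          ∏ j, wb (y k - k.removeNth y j) * wb (k.removeNth y j - y k)) *
        offKernel (Nat.le_of_succ_le_succ h) γ (Fin.tail μ) (i.removeNth x ∘ σ)
          (k.removeNth y ∘ τ) := by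
  have hprod : ∀ (x : Fin (n + 1) → ℂ) (i : Fin (n + 1)) (σ : Equiv.Perm (Fin n)),
      ∏ j, wb (x i - (i.removeNth x ∘ σ) j) * wb ((i.removeNth x ∘ σ) j - x i) =
        ∏ j, wb (x i - i.removeNth x j) * wb (i.removeNth x j - x i) := fun x i σ =>
    Equiv.prod_comp σ fun j => wb (x i - i.removeNth x j) * wb (i.removeNth x j - x i)
  have hhead : ∀ (x : Fin (n + 1) → ℂ) (i : Fin (n + 1)) (σ : Equiv.Perm (Fin n)),
      (x ∘ consPerm i σ) 0 = x i := fun x i σ => congrArg x (consPerm_zero i σ)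
  rw [offKernel_succ, offLevel_zero h γ μ (hx.comp_perm _) (hy.comp_perm _),
    recursionCoeff_comp_perm, numeratorR_zero_comp_perm]
  simp only [tail_comp_consPerm, consPerm_zero, hhead, hprod]

theorem scalarProduct_eq_sum_perm (h : n ≤ L) (γ : ℂ) (μ : Fin L → ℂ) {x y : Fin n → ℂ}
    (hx : Separated x) (hy : Separated y)
    (hN : ∀ (π ρ : Equiv.Perm (Fin n)) (i), numeratorR h γ μ (x ∘ π) (y ∘ ρ) i ≠ 0) :
    scalarProduct γ μ x y =
      (∑ π : Equiv.Perm (Fin n), ∑ ρ : Equiv.Perm (Fin n), offKernel h γ μ (x ∘ π) (y ∘ ρ)) /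
        (hypDiscr x * hypDiscr y) := by
  induction n generalizing L with
  | zero =>
    rw [scalarProduct_eq_pairing, pairing, vacuum_dotProduct_mulVec]
    simp [offKernel, hypDiscr, opProd]
  | succ n ih =>
    obtain ⟨L, rfl⟩ : ∃ L', L = L' + 1 := ⟨L - 1, by omega⟩
    have hN0 : numeratorR h γ μ x y 0 ≠ 0 := hN 1 1 0
    refine mul_left_cancel₀ hN0 ?_
    rw [numeratorR_mul_scalarProduct h γ μ hx hy, sum_perm_succ, Finset.mul_sum, Finset.sum_div,
      Finset.mul_sum]
    refine Finset.sum_congr rfl fun i _ => ?_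
    rw [Finset.sum_congr rfl fun σ _ => sum_perm_succ _, Finset.sum_comm, Finset.mul_sum,
      Finset.sum_div, Finset.mul_sum]
    refine Finset.sum_congr rfl fun k _ => ?_
    have hDx := hx.hypDiscr_ne_zero
    have hDy := hy.hypDiscr_ne_zero
    rw [hypDiscr_succAbove x i] at hDx ⊢
    rw [hypDiscr_succAbove y k] at hDy ⊢
    rw [ih (Nat.le_of_succ_le_succ h) (Fin.tail μ) (hx.removeNth i) (hy.removeNth k) fun σ τ j => by
      simpa only [numeratorR_succ, tail_comp_consPerm] using
        hN (consPerm i σ) (consPerm k τ) j.succ]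
    simp only [offKernel_comp_consPerm h γ μ hx hy, ← Finset.mul_sum]
    have hPx := left_ne_zero_of_mul hDx
    have hPy := left_ne_zero_of_mul hDy
    have hQx := right_ne_zero_of_mul hDx
    have hQy := right_ne_zero_of_mul hDy
    field_simp

end SumFormula

/-! ### The on-shell kernel -/

section Products

variable {M : Type*} [CommMonoid M] {L n : ℕ}

lemma prod_Iio_castLE (h : n ≤ L) (i : Fin n) (f : Fin L → M) :
    ∏ k ∈ Finset.Iio (Fin.castLE h i), f k = ∏ k ∈ Finset.Iio i, f (Fin.castLE h k) := by
  rw [← Fin.map_castLEEmb_Iio, Finset.prod_map]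
  rfl

lemma prod_Iio_mul_prod_Ici (i : Fin n) (f : Fin n → M) :
    (∏ k ∈ Finset.Iio i, f k) * ∏ k ∈ Finset.Ici i, f k = ∏ k, f k := by
  have hcompl : (Finset.Iio i)ᶜ = Finset.Ici i := by ext; simp
  rw [← hcompl, Finset.prod_mul_prod_compl]

lemma prod_Iio_mul_prod_Ioi (i : Fin n) (f : Fin n → M) :
    (∏ k ∈ Finset.Iio i, f k) * ∏ k ∈ Finset.Ioi i, f k = ∏ k ∈ Finset.univ.erase i, f k := by
  rw [mul_comm, ← Finset.prod_disjUnion (Finset.disjoint_Ioi_Iio i), Finset.Ioi_disjUnion_Iio,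
    Finset.compl_singleton]

lemma prod_prod_Iio_comm (f : Fin n → Fin n → M) :
    ∏ i, ∏ k ∈ Finset.Iio i, f i k = ∏ i, ∏ k ∈ Finset.Ioi i, f k i :=
  Finset.prod_comm' (by simp)

lemma neg_one_pow_mul_prod_Ioi :
    (-1 : ℂ) ^ (n * (n + 1) / 2) * ∏ i : Fin n, ∏ _k ∈ Finset.Ioi i, (-1 : ℂ) = (-1) ^ n := by
  have hsum : ∑ i : Fin n, (n - 1 - i) = n * (n - 1) / 2 := by
    rw [Fin.sum_univ_eq_sum_range fun i => n - 1 - i, Finset.sum_range_reflect fun i => i,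
      Finset.sum_range_id]
  have hexp : n * (n + 1) / 2 = n * (n - 1) / 2 + n := by
    simpa [mul_comm] using Nat.triangle_succ n
  simp only [Finset.prod_const, Fin.card_Ioi, Finset.prod_pow_eq_pow_sum, hsum]
  rw [hexp, pow_add, mul_right_comm, ← mul_pow]
  simp

lemma neg_one_pow_mul_prod_wb_sub (v : Fin n → ℂ) :
    (-1) ^ (n * (n + 1) / 2) * ∏ i, ∏ k ∈ Finset.Ioi i, wb (v k - v i) =
      (-1) ^ n * ∏ i, ∏ k ∈ Finset.Ioi i, wb (v i - v k) := by
  have hsub : ∏ i, ∏ k ∈ Finset.Ioi i, wb (v k - v i) =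
      (∏ i : Fin n, ∏ _k ∈ Finset.Ioi i, (-1 : ℂ)) * ∏ i, ∏ k ∈ Finset.Ioi i, wb (v i - v k) := by
    simp only [← Finset.prod_mul_distrib, neg_one_mul, ← wb_sub_comm]
  rw [hsub, ← mul_assoc, neg_one_pow_mul_prod_Ioi]

lemma prod_prod_eq_prod_Ioi_mul_prod_Ici (h : n ≤ L) (f : Fin n → Fin L → M) :
    ∏ i, ∏ j, f i j = (∏ i, ∏ k ∈ Finset.Ioi i, f k (Fin.castLE h i)) *
      ∏ i, ∏ j ∈ Finset.Ici (Fin.castLE h i), f i j := by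
  rw [← prod_prod_Iio_comm fun i k => f i (Fin.castLE h k), ← Finset.prod_mul_distrib]
  simp only [← prod_Iio_castLE, prod_Iio_mul_prod_Ici]

end Products

section OnShell

variable {L n : ℕ} (h : n ≤ L) (γ φ₁ φ₂ : ℂ) (μ : Fin L → ℂ) (w v : Fin n → ℂ)

/-- `Λ_i^{ON}` multiplied by its denominators. -/
noncomputable def regLambda (i : Fin n) : ℂ :=
  (-1) ^ n * ((∏ k ∈ Finset.Iio i, wa γ (v i - μ (Fin.castLE h k))) *
      ∏ k ∈ Finset.Iio i, wa γ (v k - v i)) *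
      (∏ k ∈ Finset.Ici (Fin.castLE h i), wa γ (w i - μ k)) *
      (∏ k ∈ Finset.Ioi i, wa γ (w k - w i)) +
    φ₂ * φ₁⁻¹ * ((∏ k ∈ Finset.Iio i, wb (v i - μ (Fin.castLE h k))) *
      ∏ k ∈ Finset.Iio i, wa γ (v i - v k)) *
      (∏ k ∈ Finset.Ici (Fin.castLE h i), wb (w i - μ k)) *
      (∏ k ∈ Finset.Ioi i, wa γ (w i - w k))

/-- The on-shell kernel without its removable singularities: the only poles left are the zeros of
the numerators of the `R_i`. -/
noncomputable def regKernel : ℂ :=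
  (-1) ^ (n * (n + 1) / 2) * wc γ ^ (2 * n) * (∏ i, ∏ j, wb (v i - μ j)) *
    (∏ i, ∏ j ∈ Finset.Ioi i, wb (v j - v i) * (wa γ (w j - μ (Fin.castLE h i)) *
      (wb (w j - w i) * wb (w j - μ (Fin.castLE h i))))) *
    ∏ i, regLambda h γ φ₁ φ₂ μ w v i / numeratorR h γ μ w v i

variable {h γ μ w v}

lemma RegularAt.inv_factorR (hr : RegularAt h γ μ w v) (i : Fin n) :
    (factorR h γ μ w v i)⁻¹ =
      (wb (w i - μ (Fin.castLE h i)) * ∏ k ∈ Finset.Ioi i, wb (w k - μ (Fin.castLE h i))) *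
      (wb (v i - μ (Fin.castLE h i)) * ∏ k ∈ Finset.Ioi i, wb (v k - μ (Fin.castLE h i))) /
        numeratorR h γ μ w v i := by
  have hw : ∏ k ∈ Finset.Ici i, wb (w k - μ (Fin.castLE h i)) ≠ 0 :=
    Finset.prod_ne_zero_iff.2 fun k hk => hr.w_mu i k (Finset.mem_Ici.1 hk)
  have hv : ∏ k ∈ Finset.Ici i, wb (v k - μ (Fin.castLE h i)) ≠ 0 :=
    Finset.prod_ne_zero_iff.2 fun k hk => hr.v_mu i k (Finset.mem_Ici.1 hk)
  rw [Finset.mul_prod_Ioi_eq_prod_Ici (f := fun k => wb (w k - μ (Fin.castLE h i))),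
    Finset.mul_prod_Ioi_eq_prod_Ici (f := fun k => wb (v k - μ (Fin.castLE h i))),
    inv_eq_iff_eq_inv, inv_div, factorR, numeratorR]
  simp only [Finset.prod_div_distrib, Finset.prod_mul_distrib]
  rw [div_sub_div _ _ hw hv]
  ring

lemma RegularAt.lambdaON_eq (hr : RegularAt h γ μ w v) (i : Fin n) :
    lambdaON h γ φ₁ φ₂ μ w v i =
      regLambda h γ φ₁ φ₂ μ w v i / ((∏ k ∈ Finset.Iio i, wb (v i - μ (Fin.castLE h k))) *
        (∏ k ∈ Finset.Iio i, wa γ (v i - μ (Fin.castLE h k))) *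
        ∏ k ∈ Finset.Iio i, wa γ (v k - v i)) := by
  have hb : ∏ k ∈ Finset.Iio i, wb (v i - μ (Fin.castLE h k)) ≠ 0 :=
    Finset.prod_ne_zero_iff.2 fun k hk => hr.v_mu k i (Finset.mem_Iio.1 hk).le
  have ha : ∏ k ∈ Finset.Iio i, wa γ (v i - μ (Fin.castLE h k)) ≠ 0 :=
    Finset.prod_ne_zero_iff.2 fun k hk => hr.v_mu' i k (Finset.mem_Iio.1 hk)
  have hvv : ∏ k ∈ Finset.Iio i, wa γ (v k - v i) ≠ 0 :=
    Finset.prod_ne_zero_iff.2 fun k hk => hr.v_v i k (Finset.mem_Iio.1 hk)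
  simp only [lambdaON, regLambda, Finset.prod_div_distrib, prod_Iio_castLE]
  generalize ∏ k ∈ Finset.Iio i, wb (v i - μ (Fin.castLE h k)) = p at *
  generalize ∏ k ∈ Finset.Iio i, wa γ (v i - μ (Fin.castLE h k)) = q at *
  generalize ∏ k ∈ Finset.Iio i, wa γ (v k - v i) = r at *
  field_simp

theorem RegularAt.kernelON_eq_regKernel (hr : RegularAt h γ μ w v) :
    kernelON h γ φ₁ φ₂ μ w v = regKernel h γ φ₁ φ₂ μ w v := by
  have hwμ : ∏ i, wb (w i - μ (Fin.castLE h i)) ≠ 0 :=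
    Finset.prod_ne_zero_iff.2 fun i _ => hr.w_mu i i le_rfl
  have hvμ : ∏ i, wb (v i - μ (Fin.castLE h i)) ≠ 0 :=
    Finset.prod_ne_zero_iff.2 fun i _ => hr.v_mu i i le_rfl
  have hbμ : ∏ i, ∏ k ∈ Finset.Ioi i, wb (v k - μ (Fin.castLE h i)) ≠ 0 :=
    Finset.prod_ne_zero_iff.2 fun i _ => Finset.prod_ne_zero_iff.2 fun k hk =>
      hr.v_mu i k (Finset.mem_Ioi.1 hk).le
  have haμ : ∏ i, ∏ k ∈ Finset.Ioi i, wa γ (v k - μ (Fin.castLE h i)) ≠ 0 :=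
    Finset.prod_ne_zero_iff.2 fun i _ => Finset.prod_ne_zero_iff.2 fun k hk =>
      hr.v_mu' k i (Finset.mem_Ioi.1 hk)
  have hvv : ∏ i, ∏ k ∈ Finset.Ioi i, wa γ (v i - v k) ≠ 0 :=
    Finset.prod_ne_zero_iff.2 fun i _ => Finset.prod_ne_zero_iff.2 fun k hk =>
      hr.v_v k i (Finset.mem_Ioi.1 hk)
  simp only [kernelON, regKernel, hr.inv_factorR, hr.lambdaON_eq, Finset.prod_mul_distrib,
    Finset.prod_div_distrib, prod_prod_Iio_comm]
  generalize ∏ i, wb (w i - μ (Fin.castLE h i)) = bw at *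
  generalize ∏ i, wb (v i - μ (Fin.castLE h i)) = bv at *
  generalize ∏ i, ∏ k ∈ Finset.Ioi i, wb (v k - μ (Fin.castLE h i)) = b at *
  generalize ∏ i, ∏ k ∈ Finset.Ioi i, wa γ (v k - μ (Fin.castLE h i)) = a at *
  generalize ∏ i, ∏ k ∈ Finset.Ioi i, wa γ (v i - v k) = avv at *
  generalize ∏ i, ∏ k ∈ Finset.Ioi i, wb (v k - v i) = bvv
  generalize ∏ i, ∏ k ∈ Finset.Ioi i, wa γ (w k - μ (Fin.castLE h i)) = aw
  generalize ∏ i, ∏ k ∈ Finset.Ioi i, wb (w k - w i) = bww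
  generalize ∏ i, ∏ k ∈ Finset.Ioi i, wb (w k - μ (Fin.castLE h i)) = bwμ
  generalize ∏ i, ∏ j, wb (v i - μ j) = B
  generalize ∏ i, regLambda h γ φ₁ φ₂ μ w v i = Λ
  generalize ∏ i, numeratorR h γ μ w v i = N
  generalize (-1 : ℂ) ^ (n * (n + 1) / 2) * wc γ ^ (2 * n) = s
  field_simp

variable {φ₁ φ₂}
variable (w)

lemma BetheEquations.mul_regLambda (hv : BetheEquations γ φ₁ φ₂ μ v) (i : Fin n) :
    ((∏ k ∈ Finset.Ici (Fin.castLE h i), wb (v i - μ k)) *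
        ∏ k ∈ Finset.Ioi i, wa γ (v i - v k)) * regLambda h γ φ₁ φ₂ μ w v i =
      (-1) ^ n * ((∏ k ∈ Finset.Iio i, wa γ (v i - μ (Fin.castLE h k))) *
        ∏ k ∈ Finset.Iio i, wa γ (v k - v i)) * offLambda h γ μ w v i := by
  have hbethe := hv.equation i
  have hb : ∏ j, wb (v i - μ j) ≠ 0 := Finset.prod_ne_zero_iff.2 fun j _ => hv.b_ne_zero i j
  have ha : ∏ k ∈ Finset.univ.erase i, wa γ (v k - v i) ≠ 0 :=
    Finset.prod_ne_zero_iff.2 fun k hk => hv.a_ne_zero i k (Finset.ne_of_mem_erase hk)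
  have hsign : (-1 : ℂ) ^ n = -(-1) ^ (n - 1) := by
    rw [← pow_sub_one_mul i.pos.ne', mul_neg_one]
  have hsq : ((-1 : ℂ) ^ (n - 1)) * (-1) ^ (n - 1) = 1 := by
    rw [← mul_pow]; simp
  rw [Finset.prod_div_distrib, Finset.prod_div_distrib, ← mul_div_assoc, div_eq_div_iff hb ha,
    ← prod_Iio_mul_prod_Ioi, ← prod_Iio_mul_prod_Ioi, ← prod_Iio_mul_prod_Ici (Fin.castLE h i),
    ← prod_Iio_mul_prod_Ici (Fin.castLE h i), prod_Iio_castLE, prod_Iio_castLE,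
    div_eq_mul_inv] at hbethe
  rw [regLambda, offLambda, hsign]
  simp only [Finset.prod_mul_distrib]
  generalize (-1 : ℂ) ^ (n - 1) = s at *
  linear_combination
    -s * (∏ k ∈ Finset.Ici (Fin.castLE h i), wb (w i - μ k)) *
        (∏ k ∈ Finset.Ioi i, wa γ (w i - w k)) * hbethe -
      (∏ k ∈ Finset.Ici (Fin.castLE h i), wb (v i - μ k)) *
        (∏ k ∈ Finset.Ioi i, wa γ (v i - v k)) * φ₂ * φ₁⁻¹ *
        (∏ k ∈ Finset.Iio i, wb (v i - μ (Fin.castLE h k))) *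
        (∏ k ∈ Finset.Iio i, wa γ (v i - v k)) *
        (∏ k ∈ Finset.Ici (Fin.castLE h i), wb (w i - μ k)) *
        (∏ k ∈ Finset.Ioi i, wa γ (w i - w k)) * hsq

theorem BetheEquations.regKernel_eq_offKernel (hv : BetheEquations γ φ₁ φ₂ μ v) :
    regKernel h γ φ₁ φ₂ μ w v = offKernel h γ μ w v := by
  have hvv : ∏ i, ∏ k ∈ Finset.Ioi i, wa γ (v i - v k) ≠ 0 :=
    Finset.prod_ne_zero_iff.2 fun i _ => Finset.prod_ne_zero_iff.2 fun k hk =>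
      hv.a_ne_zero k i (Finset.mem_Ioi.1 hk).ne
  have hΛ := Fintype.prod_congr _ _ (hv.mul_regLambda (h := h) w)
  have hsign : (-1 : ℂ) ^ n * ((-1) ^ n) ^ n = 1 := by
    rw [← pow_succ', ← pow_mul, (Nat.even_mul_succ_self n).neg_one_pow]
  have hvsub := neg_one_pow_mul_prod_wb_sub v
  simp only [Finset.prod_mul_distrib, prod_prod_Iio_comm, Finset.prod_const, Finset.card_univ,
    Fintype.card_fin] at hΛ
  refine mul_left_cancel₀ hvv ?_
  rw [regKernel, offKernel, prod_prod_eq_prod_Ioi_mul_prod_Ici h]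
  simp only [offLevel, Finset.prod_mul_distrib, Finset.prod_const, Finset.card_univ,
    Fintype.card_fin, ← pow_mul, div_eq_mul_inv] at hΛ ⊢
  generalize ∏ i, (numeratorR h γ μ w v i)⁻¹ = N at *
  generalize wc γ ^ (2 * n) = c at *
  generalize ∏ i, ∏ k ∈ Finset.Ioi i, wb (v k - μ (Fin.castLE h i)) = b at *
  generalize ∏ i, ∏ k ∈ Finset.Ici (Fin.castLE h i), wb (v i - μ k) = b' at *
  generalize ∏ i, ∏ k ∈ Finset.Ioi i, wa γ (v k - μ (Fin.castLE h i)) = a at *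
  generalize ∏ i, ∏ k ∈ Finset.Ioi i, wa γ (v i - v k) = avv at *
  generalize ∏ i, ∏ k ∈ Finset.Ioi i, wb (v i - v k) = bvv at *
  generalize ∏ i, ∏ k ∈ Finset.Ioi i, wa γ (w k - μ (Fin.castLE h i)) = aw at *
  generalize ∏ i, ∏ k ∈ Finset.Ioi i, wb (w k - w i) = bww at *
  generalize ∏ i, ∏ k ∈ Finset.Ioi i, wb (w k - μ (Fin.castLE h i)) = bwμ at *
  generalize ∏ i, regLambda h γ φ₁ φ₂ μ w v i = Λ at *
  generalize ∏ i, offLambda h γ μ w v i = Ω at *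
  linear_combination (c * b * aw * bww * bwμ * N) *
    (b' * avv * Λ * hvsub + (-1) ^ n * bvv * hΛ + bvv * a * avv * Ω * hsign)

end OnShell

section Iteration

variable {L n : ℕ} (h : n ≤ L) (γ φ₁ φ₂ : ℂ) (μ : Fin L → ℂ) (w v : Fin n → ℂ)

lemma kernelRec_eq_prod_Ici (s : ℕ) (hs : s < n) :
    kernelRec h γ φ₁ φ₂ μ w v s hs = ∏ i ∈ Finset.Ici (⟨s, hs⟩ : Fin n),
      if (i : ℕ) + 1 < n then recCoeff h γ φ₁ φ₂ μ w v i else recLast h γ φ₁ φ₂ μ w v i := by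
  rw [kernelRec, ← Finset.mul_prod_Ioi_eq_prod_Ici]
  by_cases hs' : s + 1 < n
  · have hIoi : Finset.Ioi (⟨s, hs⟩ : Fin n) = Finset.Ici ⟨s + 1, hs'⟩ := by
      ext i; simp [Fin.lt_def, Fin.le_def]
    rw [dif_pos hs', kernelRec_eq_prod_Ici (s + 1) hs', hIoi, if_pos hs']
  · have hmax : IsMax (⟨s, hs⟩ : Fin n) := fun i _ => Fin.mk_le_mk.2 (by omega)
    rw [dif_neg hs', Finset.Ioi_eq_empty.2 hmax, if_neg hs', Finset.prod_empty, mul_one]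
termination_by n - s

/-- The `s`-th factor of the kernel `H`, without its sign. -/
noncomputable def kernelFactor (s : Fin n) : ℂ :=
  wc γ ^ 2 * ((∏ k, wb (v s - μ k)) *
      (∏ k ∈ Finset.Ioi s, wa γ (w k - μ (Fin.castLE h s)) * wb (w k - w s)) /
        (wb (w s - μ (Fin.castLE h s)) * wb (v s - μ (Fin.castLE h s)))) *
    (∏ k ∈ Finset.Ioi s, wa γ (v s - v k) * wa γ (v k - μ (Fin.castLE h s)) * wb (v k - v s)) *
    ((factorR h γ μ w v s)⁻¹ * lambdaON h γ φ₁ φ₂ μ w v s)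

lemma kernelON_eq_prod_kernelFactor :
    kernelON h γ φ₁ φ₂ μ w v =
      (-1) ^ (n * (n + 1) / 2) * ∏ s, kernelFactor h γ φ₁ φ₂ μ w v s := by
  simp only [kernelON, kernelFactor, Finset.prod_mul_distrib, Finset.prod_inv_distrib,
    Finset.prod_const, Finset.card_univ, Fintype.card_fin, pow_mul, div_eq_mul_inv, mul_inv]
  ring

lemma mul_recCoeff (s : Fin n) (hs : ∀ k, Fin.castLE h s < k →
      wa γ (μ (Fin.castLE h s) - μ k) ≠ 0 ∧ wa γ (μ k - μ (Fin.castLE h s)) ≠ 0) :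
    wc γ ^ 2 * (∏ k ∈ Finset.Ioi (Fin.castLE h s),
        wa γ (μ (Fin.castLE h s) - μ k) * wa γ (μ k - μ (Fin.castLE h s))) *
        recCoeff h γ φ₁ φ₂ μ w v s =
      (-1) ^ L * kernelFactor h γ φ₁ φ₂ μ w v s := by
  have hD : ∏ k ∈ Finset.Ioi (Fin.castLE h s),
      wa γ (μ (Fin.castLE h s) - μ k) * wa γ (μ k - μ (Fin.castLE h s)) ≠ 0 :=
    Finset.prod_ne_zero_iff.2 fun k hk =>
      mul_ne_zero (hs k (Finset.mem_Ioi.1 hk)).1 (hs k (Finset.mem_Ioi.1 hk)).2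
  have hcancel := mul_inv_cancel₀ hD
  generalize hF : kernelFactor h γ φ₁ φ₂ μ w v s = F
  rw [kernelFactor] at hF
  rw [recCoeff]
  generalize ∏ k ∈ Finset.Ioi (Fin.castLE h s),
    wa γ (μ (Fin.castLE h s) - μ k) * wa γ (μ k - μ (Fin.castLE h s)) = D at *
  linear_combination (-1) ^ L * D * D⁻¹ * hF + (-1) ^ L * F * hcancel

lemma recLast_last {m : ℕ} (h : m + 1 ≤ L) (γ φ₁ φ₂ : ℂ) (μ : Fin L → ℂ)
    (w v : Fin (m + 1) → ℂ) :
    recLast h γ φ₁ φ₂ μ w v (Fin.last m) =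
      (-1) ^ (m + 1) * kernelFactor h γ φ₁ φ₂ μ w v (Fin.last m) := by
  have hIoi : Finset.Ioi (Fin.last m) = ∅ := Finset.Ioi_eq_empty.2 fun i _ => Fin.le_last i
  rw [recLast, kernelFactor, hIoi]
  simp only [Finset.prod_empty]
  ring

lemma neg_one_pow_triangle_succ (m : ℕ) :
    (-1 : ℂ) ^ ((m + 1) * (m + 2) / 2) =
      (-1) ^ (m * L + (m + 1) * m / 2) * (((-1) ^ L) ^ m * (-1) ^ (m + 1)) := by
  have hexp : (m + 1) * (m + 2) / 2 = (m + 1) * m / 2 + (m + 1) := by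
    simpa [mul_comm] using Nat.triangle_succ (m + 1)
  have hsq : (-1 : ℂ) ^ (m * L) * ((-1) ^ L) ^ m = 1 := by
    rw [mul_comm m L, pow_mul, ← mul_pow, ← mul_pow]; simp
  rw [hexp, pow_add, pow_add (-1 : ℂ) (m * L)]
  linear_combination -((-1 : ℂ) ^ ((m + 1) * m / 2) * (-1) ^ (m + 1)) * hsq

theorem kernelON_eq_recNorm_mul_kernelRec (hn : 0 < n)
    (hμ : ∀ s k : Fin L, (s : ℕ) + 1 < n → s < k →
      wa γ (μ s - μ k) ≠ 0 ∧ wa γ (μ k - μ s) ≠ 0) :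
    kernelON h γ φ₁ φ₂ μ w v = recNorm h γ μ * kernelRec h γ φ₁ φ₂ μ w v 0 hn := by
  obtain ⟨m, rfl⟩ : ∃ m, n = m + 1 := ⟨n - 1, by omega⟩
  have hcoeff := Fintype.prod_congr _ _ fun i : Fin m =>
    mul_recCoeff h γ φ₁ φ₂ μ w v i.castSucc fun k => hμ _ k (by simp)
  have hIci : Finset.Ici (⟨0, hn⟩ : Fin (m + 1)) = Finset.univ := by ext i; simp
  rw [kernelON_eq_prod_kernelFactor, kernelRec_eq_prod_Ici, recNorm, Finset.prod_filter, hIci,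
    neg_one_pow_triangle_succ (L := L)]
  simp only [Fin.prod_univ_castSucc, Fin.val_castSucc, Fin.val_last, add_lt_add_iff_right,
    Fin.is_lt, if_true, lt_irrefl, if_false, mul_one, recLast_last, Nat.add_sub_cancel, pow_mul,
    Finset.prod_mul_distrib, Finset.prod_const, Finset.card_univ, Fintype.card_fin] at hcoeff ⊢
  linear_combination -((-1 : ℂ) ^ (m * L + (m + 1) * m / 2) * (-1) ^ (m + 1) *
    kernelFactor h γ φ₁ φ₂ μ w v (Fin.last m)) * hcoeff

end Iteration

/-! ### Residues -/

section Residues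

theorem prod_sub_inv_eq_sum {ι F : Type*} [Fintype ι] [DecidableEq ι] [Nonempty ι] [Field F]
    {p : ι → F} (hp : Function.Injective p) {z : F} (hz : ∀ j, z ≠ p j) :
    (∏ j, (z - p j))⁻¹ =
      ∑ j, (z - p j)⁻¹ / ∏ k ∈ Finset.univ.erase j, (p j - p k) := by
  have hsum := Lagrange.eval_interpolate_not_at_node (s := Finset.univ) (v := p) (x := z) 1
    fun j _ => hz j
  rw [Lagrange.interpolate_one hp.injOn Finset.univ_nonempty, Lagrange.eval_nodal] at hsum
  simp only [Polynomial.eval_one, Pi.one_apply, mul_one, Lagrange.nodalWeight,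
    Finset.prod_inv_distrib] at hsum
  rw [inv_eq_of_mul_eq_one_right hsum.symm]
  exact Finset.sum_congr rfl fun j _ => by rw [mul_comm, div_eq_mul_inv]

theorem circleIntegral_sub_inv_mul {c p : ℂ} {r : ℝ} {f : ℂ → ℂ} (hr : 0 ≤ r)
    (hf : DiffContOnCl ℂ f (Metric.ball c r)) (hp : p ∉ Metric.sphere c r) :
    (∮ z in C(c, r), (z - p)⁻¹ * f z) =
      2 * Real.pi * I * ((Metric.ball c r).indicator 1 p * f p) := by
  by_cases hmem : p ∈ Metric.ball c r
  · simpa [hmem] using hf.circleIntegral_sub_inv_smul hmem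
  · have hclosure : ∀ z ∈ closure (Metric.ball c r), z - p ≠ 0 := by
      intro z hz hzp
      rw [sub_eq_zero.1 hzp] at hz
      have := Metric.closure_ball_subset_closedBall hz
      rw [← Metric.ball_union_sphere] at this
      exact this.elim hmem hp
    have hinv : DiffContOnCl ℂ (fun z => (z - p)⁻¹) (Metric.ball c r) :=
      (differentiable_id.diffContOnCl.sub_const p).inv hclosure
    simpa [hmem] using (hinv.smul hf).circleIntegral_eq_zero hr

theorem circleIntegral_div_prod_sub {ι : Type*} [Fintype ι] [DecidableEq ι] {c : ℂ} {r : ℝ}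
    {f : ℂ → ℂ} {p : ι → ℂ} (hr : 0 ≤ r) (hf : DiffContOnCl ℂ f (Metric.ball c r))
    (hp : Function.Injective p) (hpc : ∀ j, p j ∉ Metric.sphere c r) :
    (∮ z in C(c, r), f z / ∏ j, (z - p j)) = 2 * Real.pi * I *
      ∑ j, (Metric.ball c r).indicator 1 (p j) *
        (f (p j) / ∏ k ∈ Finset.univ.erase j, (p j - p k)) := by
  cases isEmpty_or_nonempty ι
  · simpa using hf.circleIntegral_eq_zero hr
  have hne : ∀ z ∈ Metric.sphere c r, ∀ j, z ≠ p j := fun z hz j hzp => hpc j (hzp ▸ hz)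
  have hpartial : Set.EqOn (fun z => f z / ∏ j, (z - p j))
      (fun z => ∑ j, (∏ k ∈ Finset.univ.erase j, (p j - p k))⁻¹ * ((z - p j)⁻¹ * f z))
      (Metric.sphere c r) := by
    intro z hz
    simp only [div_eq_mul_inv (f z), prod_sub_inv_eq_sum hp (hne z hz), Finset.mul_sum]
    exact Finset.sum_congr rfl fun j _ => by ring
  have hint : ∀ j, CircleIntegrable
      (fun z => (∏ k ∈ Finset.univ.erase j, (p j - p k))⁻¹ * ((z - p j)⁻¹ * f z)) c r := by
    refine fun j => ContinuousOn.circleIntegrable hr (continuousOn_const.mul (.mul (.inv₀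
      (by fun_prop) fun z hz => sub_ne_zero.2 (hne z hz j)) (hf.continuousOn_ball.mono ?_)))
    exact Metric.sphere_subset_closedBall
  rw [circleIntegral.integral_congr hr hpartial,
    circleIntegral.integral_fun_sum fun j _ => hint j, Finset.mul_sum]
  refine Finset.sum_congr rfl fun j _ => ?_
  rw [circleIntegral.integral_const_mul, circleIntegral_sub_inv_mul hr hf (hpc j)]
  ring

/-- The entire function `sinh z / z`, the cofactor of the simple zero of `wb` at `0`. -/
noncomputable def sinhc : ℂ → ℂ := dslope sinh 0

lemma wb_eq_mul_sinhc (z : ℂ) : wb z = z * sinhc z := by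
  simpa [wb, sinhc] using (sub_smul_dslope sinh 0 z).symm

lemma sinhc_zero : sinhc 0 = 1 := by
  simp [sinhc, dslope_same]

@[fun_prop]
lemma differentiable_sinhc : Differentiable ℂ sinhc :=
  differentiableOn_univ.1 ((differentiableOn_dslope Filter.univ_mem).2
    differentiable_sinh.differentiableOn)

variable {N : ℕ} {Γ : Finset (ℂ × ℝ)} {p : Fin N → ℂ}

lemma closedBall_subset_region {d : ℂ × ℝ} (hd : d ∈ Γ) : Metric.closedBall d.1 d.2 ⊆ region Γ :=
  Set.subset_biUnion_of_mem (u := fun d : ℂ × ℝ => Metric.closedBall d.1 d.2) hd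

lemma sphere_subset_curve {d : ℂ × ℝ} (hd : d ∈ Γ) : Metric.sphere d.1 d.2 ⊆ curve Γ :=
  Set.subset_biUnion_of_mem (u := fun d : ℂ × ℝ => Metric.sphere d.1 d.2) hd

lemma curve_subset_region : curve Γ ⊆ region Γ :=
  Set.biUnion_mono subset_rfl fun _ _ => Metric.sphere_subset_closedBall

namespace Encloses

lemma mem_region (hE : Encloses Γ p) (j : Fin N) : p j ∈ region Γ :=
  let ⟨_, hd, hj⟩ := hE.mem j
  closedBall_subset_region hd (Metric.ball_subset_closedBall hj)

lemma separated (hE : Encloses Γ p) (hp : Function.Injective p) : Separated p :=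
  fun i j hij hb => hij (hp (hE.solely _ (hE.mem_region i) j hb))

lemma sinhc_ne_zero (hE : Encloses Γ p) {z : ℂ} (hz : z ∈ region Γ) (j : Fin N) :
    sinhc (z - p j) ≠ 0 := by
  intro hzero
  have hzp := hE.solely z hz j (by rw [wb_eq_mul_sinhc, hzero, mul_zero])
  rw [hzp, sub_self, sinhc_zero] at hzero
  exact one_ne_zero hzero

lemma notMem_curve (hE : Encloses Γ p) (j : Fin N) : p j ∉ curve Γ := by
  intro hj
  obtain ⟨d, hd, hsphere⟩ := Set.mem_iUnion₂.1 hj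
  obtain ⟨d', hd', hball⟩ := hE.mem j
  rcases eq_or_ne d d' with rfl | hne
  · exact (Metric.mem_ball.1 hball).ne (Metric.mem_sphere.1 hsphere)
  · exact Set.disjoint_left.1 (hE.disjoint hd hd' hne) (Metric.sphere_subset_closedBall hsphere)
      (Metric.ball_subset_closedBall hball)

lemma wb_ne_zero (hE : Encloses Γ p) {z : ℂ} (hz : z ∈ curve Γ) (j : Fin N) :
    wb (z - p j) ≠ 0 := fun hb =>
  hE.notMem_curve j (hE.solely z (curve_subset_region hz) j hb ▸ hz)

lemma sum_indicator_ball (hE : Encloses Γ p) (j : Fin N) :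
    ∑ d : Γ, (Metric.ball d.1.1 d.1.2).indicator 1 (p j) = (1 : ℂ) := by
  obtain ⟨d, hd, hj⟩ := hE.mem j
  rw [Finset.sum_eq_single ⟨d, hd⟩ _ (by simp)]
  · simp [hj]
  · refine fun d' _ hne => Set.indicator_of_notMem (fun hj' => ?_) 1
    exact Set.disjoint_left.1 (hE.disjoint d'.2 hd fun heq => hne (Subtype.ext heq))
      (Metric.ball_subset_closedBall hj') (Metric.ball_subset_closedBall hj)

theorem circleIntegral_div_prod_wb (hE : Encloses Γ p) (hp : Function.Injective p) {d : ℂ × ℝ}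
    (hd : d ∈ Γ) {g : ℂ → ℂ} (hg : DifferentiableOn ℂ g (region Γ)) :
    (∮ z in C(d.1, d.2), g z / ∏ j, wb (z - p j)) = 2 * Real.pi * I *
      ∑ j, (Metric.ball d.1 d.2).indicator 1 (p j) *
        (g (p j) / ∏ k ∈ Finset.univ.erase j, wb (p j - p k)) := by
  have hquot : DifferentiableOn ℂ (fun z => g z / ∏ j, sinhc (z - p j)) (region Γ) :=
    hg.div (by fun_prop) fun z hz =>
      Finset.prod_ne_zero_iff.2 fun j _ => hE.sinhc_ne_zero hz j
  have hcauchy := circleIntegral_div_prod_sub (hE.radius_pos d hd).le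
    (hquot.diffContOnCl_ball (closedBall_subset_region hd)) hp
    fun j hj => hE.notMem_curve j (sphere_subset_curve hd hj)
  have hsplit : ∀ z, g z / ∏ j, wb (z - p j) =
      g z / (∏ j, sinhc (z - p j)) / ∏ j, (z - p j) := fun z => by
    simp only [wb_eq_mul_sinhc, Finset.prod_mul_distrib, div_div, mul_comm]
  have hres : ∀ j, ∏ k ∈ Finset.univ.erase j, wb (p j - p k) =
      (∏ k, sinhc (p j - p k)) * ∏ k ∈ Finset.univ.erase j, (p j - p k) := fun j => by
    simp only [wb_eq_mul_sinhc, Finset.prod_mul_distrib]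
    rw [← Finset.mul_prod_erase _ (fun k => sinhc (p j - p k)) (Finset.mem_univ j), sub_self,
      sinhc_zero, one_mul, mul_comm]
  simpa only [hsplit, hres, div_div] using hcauchy

end Encloses

end Residues

section TorusResidues

variable {N n : ℕ} {Γ : Finset (ℂ × ℝ)} {p : Fin N → ℂ}

section Cons

variable {S : Set ℂ} {f : (Fin (n + 1) → ℂ) → ℂ}

lemma cons_mem_pi {z : ℂ} (hz : z ∈ S) {y : Fin n → ℂ} (hy : y ∈ Set.univ.pi fun _ => S) :
    (Fin.cons z y : Fin (n + 1) → ℂ) ∈ Set.univ.pi fun _ => S :=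
  fun i _ => Fin.cases hz (fun i => hy i (Set.mem_univ i)) i

lemma differentiableOn_comp_cons_left (hf : DifferentiableOn ℂ f (Set.univ.pi fun _ => S))
    {y : Fin n → ℂ} (hy : y ∈ Set.univ.pi fun _ => S) :
    DifferentiableOn ℂ (fun z : ℂ => f (Fin.cons z y)) S :=
  hf.comp (differentiable_pi.2
    (Fin.cases differentiable_id fun i => differentiable_const (y i))).differentiableOn
    fun _ hz => cons_mem_pi hz hy

lemma differentiableOn_comp_cons_right (hf : DifferentiableOn ℂ f (Set.univ.pi fun _ => S))
    {z : ℂ} (hz : z ∈ S) :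
    DifferentiableOn ℂ (fun y : Fin n → ℂ => f (Fin.cons z y)) (Set.univ.pi fun _ => S) :=
  hf.comp (differentiable_pi.2
    (Fin.cases (differentiable_const z) differentiable_apply)).differentiableOn
    fun _ hy => cons_mem_pi hz hy

end Cons

namespace Encloses

lemma torusMap_mem_curve (hE : Encloses Γ p) (d : Fin n → Γ) (θ : Fin n → ℝ) :
    torusMap (fun i => (d i).1.1) (fun i => (d i).1.2) θ ∈ Set.univ.pi fun _ => curve Γ :=
  fun i _ => Set.mem_biUnion (d i).2 <| by
    simp [torusMap, norm_exp_ofReal_mul_I, abs_of_pos (hE.radius_pos _ (d i).2)]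

lemma contourIntegral_congr (hE : Encloses Γ p) {f g : (Fin n → ℂ) → ℂ}
    (hfg : Set.EqOn f g (Set.univ.pi fun _ => curve Γ)) :
    contourIntegral Γ f = contourIntegral Γ g := by
  simp only [contourIntegral, torusIntegral, hfg (hE.torusMap_mem_curve _ _)]

lemma torusIntegrable (hE : Encloses Γ p) (d : Fin n → Γ) {f : (Fin n → ℂ) → ℂ}
    (hf : ContinuousOn f (Set.univ.pi fun _ => curve Γ)) :
    TorusIntegrable f (fun i => (d i).1.1) fun i => (d i).1.2 := by
  have hmap : Continuous (torusMap (fun i => (d i).1.1) fun i => (d i).1.2) := by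
    unfold torusMap; fun_prop
  exact (hf.comp_continuous hmap (hE.torusMap_mem_curve d)).continuousOn.integrableOn_compact
    isCompact_Icc

lemma continuousOn_div_prod_wb (hE : Encloses Γ p) {f : (Fin n → ℂ) → ℂ}
    (hf : DifferentiableOn ℂ f (Set.univ.pi fun _ => region Γ)) :
    ContinuousOn (fun w => f w / ∏ i, ∏ j, wb (w i - p j)) (Set.univ.pi fun _ => curve Γ) := by
  refine (hf.continuousOn.mono (Set.pi_mono fun _ _ => curve_subset_region)).div ?_ fun w hw =>
    Finset.prod_ne_zero_iff.2 fun i _ => Finset.prod_ne_zero_iff.2 fun j _ =>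
      hE.wb_ne_zero (hw i (Set.mem_univ i)) j
  unfold wb
  fun_prop

theorem torusIntegral_div_prod_wb (hE : Encloses Γ p) (hp : Function.Injective p)
    (d : Fin n → Γ) {f : (Fin n → ℂ) → ℂ}
    (hf : DifferentiableOn ℂ f (Set.univ.pi fun _ => region Γ)) :
    (∯ w in T(fun i => (d i).1.1, fun i => (d i).1.2), f w / ∏ i, ∏ j, wb (w i - p j)) =
      (2 * Real.pi * I) ^ n * ∑ σ : Fin n → Fin N,
        (∏ i, (Metric.ball (d i).1.1 (d i).1.2).indicator 1 (p (σ i))) *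
          (f (p ∘ σ) / ∏ i, ∏ j ∈ Finset.univ.erase (σ i), wb (p (σ i) - p j)) := by
  induction n with
  | zero => simp [Subsingleton.elim (p ∘ _) fun i => (d i).1.1]
  | succ n ih =>
    set g : ℂ → ℂ := fun z => (2 * Real.pi * I) ^ n * ∑ σ : Fin n → Fin N,
      (∏ i, (Metric.ball (d i.succ).1.1 (d i.succ).1.2).indicator 1 (p (σ i))) *
        (f (Fin.cons z (p ∘ σ)) / ∏ i, ∏ j ∈ Finset.univ.erase (σ i), wb (p (σ i) - p j)) with hg
    have hgd : DifferentiableOn ℂ g (region Γ) :=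
      .const_mul (.fun_sum fun σ _ => .const_mul (.div_const
        (differentiableOn_comp_cons_left hf fun i _ => hE.mem_region (σ i)) _) _) _
    have hinner : Set.EqOn (fun z => ∯ y in T((fun i => (d i).1.1) ∘ Fin.succ,
          (fun i => (d i).1.2) ∘ Fin.succ), f (Fin.cons z y) /
            ∏ i, ∏ j, wb ((Fin.cons z y : Fin (n + 1) → ℂ) i - p j))
        (fun z => g z / ∏ j, wb (z - p j)) (Metric.sphere (d 0).1.1 (d 0).1.2) := by
      intro z hz
      have hzr := curve_subset_region (sphere_subset_curve (d 0).2 hz)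
      have hgz := ih (fun i => d i.succ) (f := fun y => f (Fin.cons z y) / ∏ j, wb (z - p j)) <| by
        simpa only [div_eq_mul_inv] using (differentiableOn_comp_cons_right hf hzr).mul_const _
      simp only [hg, Fin.prod_univ_succ, Fin.cons_zero, Fin.cons_succ, ← div_div]
      refine hgz.trans ?_
      rw [mul_div_assoc, Finset.sum_div]
      congr! 2 with σ
      ring
    rw [torusIntegral_succ (hE.torusIntegrable d (hE.continuousOn_div_prod_wb hf)),
      circleIntegral.integral_congr (hE.radius_pos _ (d 0).2).le hinner,
      hE.circleIntegral_div_prod_wb hp (d 0).2 hgd, ← (Fin.consEquiv fun _ => Fin N).sum_comp,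
      Fintype.sum_prod_type]
    simp only [hg, Finset.mul_sum, Finset.sum_div]
    refine Finset.sum_congr rfl fun j _ => Finset.sum_congr rfl fun σ _ => ?_
    have hcomp : p ∘ (Fin.consEquiv fun _ => Fin N) (j, σ) = Fin.cons (p j) (p ∘ σ) :=
      Fin.comp_cons p j σ
    simp only [hcomp, Fin.consEquiv_apply, Fin.prod_univ_succ, Fin.cons_zero, Fin.cons_succ]
    ring

theorem contourIntegral_div_prod_wb (hE : Encloses Γ p) (hp : Function.Injective p)
    {f : (Fin n → ℂ) → ℂ} (hf : DifferentiableOn ℂ f (Set.univ.pi fun _ => region Γ)) :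
    contourIntegral Γ (fun w => f w / ∏ i, ∏ j, wb (w i - p j)) =
      ∑ σ : Fin n → Fin N, f (p ∘ σ) / ∏ i, ∏ j ∈ Finset.univ.erase (σ i), wb (p (σ i) - p j) := by
  have hpi : (2 * (Real.pi : ℂ) * I) ^ n ≠ 0 := pow_ne_zero _ two_pi_I_ne_zero
  have hone : ∀ σ : Fin n → Fin N, ∑ d : Fin n → Γ,
      ∏ i, (Metric.ball (d i).1.1 (d i).1.2).indicator 1 (p (σ i)) = (1 : ℂ) := fun σ => by
    have hexpand := Finset.prod_univ_sum (fun _ : Fin n => (Finset.univ : Finset Γ))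
      fun i d => (Metric.ball d.1.1 d.1.2).indicator (1 : ℂ → ℂ) (p (σ i))
    rw [Fintype.piFinset_univ] at hexpand
    rw [← hexpand, Finset.prod_eq_one fun i _ => hE.sum_indicator_ball (σ i)]
  simp only [contourIntegral, hE.torusIntegral_div_prod_wb hp _ hf]
  rw [← Finset.mul_sum, mul_div_cancel_left₀ _ hpi, Finset.sum_comm]
  simp only [← Finset.sum_mul, hone, one_mul]

theorem contourIntegral_div_prod_wb_eq_sum_perm {p : Fin n → ℂ} (hE : Encloses Γ p)
    (hp : Function.Injective p) {f : (Fin n → ℂ) → ℂ}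
    (hf : DifferentiableOn ℂ f (Set.univ.pi fun _ => region Γ))
    (hzero : ∀ σ : Fin n → Fin n, ¬ Function.Injective σ → f (p ∘ σ) = 0) :
    contourIntegral Γ (fun w => f w / ∏ i, ∏ j, wb (w i - p j)) =
      (∑ π : Equiv.Perm (Fin n), f (p ∘ π)) / hypDiscr p := by
  rw [hE.contourIntegral_div_prod_wb hp hf, Finset.sum_div]
  refine (Fintype.sum_of_injective _ DFunLike.coe_injective _ _ (fun σ hσ => ?_) fun π => ?_).symm
  · rw [hzero σ fun hinj => hσ ⟨.ofBijective σ (Finite.injective_iff_bijective.1 hinj), rfl⟩,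
      zero_div]
  · rw [hypDiscr, Equiv.prod_comp π fun i => ∏ j ∈ Finset.univ.erase i, wb (p i - p j)]

end Encloses

end TorusResidues

section Regularity

variable {L n : ℕ} {h : n ≤ L} {γ φ₁ φ₂ : ℂ} {μ : Fin L → ℂ} {w v : Fin n → ℂ}

@[fun_prop]
lemma differentiable_wa (γ : ℂ) : Differentiable ℂ (wa γ) := by
  unfold wa; fun_prop

@[fun_prop]
lemma differentiable_wb : Differentiable ℂ wb := by
  unfold wb; fun_prop

lemma differentiableAt_regKernel_left (hN : ∀ i, numeratorR h γ μ w v i ≠ 0) :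
    DifferentiableAt ℂ (fun w => regKernel h γ φ₁ φ₂ μ w v) w := by
  have hquot (i) : DifferentiableAt ℂ
      (fun w => regLambda h γ φ₁ φ₂ μ w v i / numeratorR h γ μ w v i) w := by
    simp only [div_eq_mul_inv]
    refine .fun_mul (by unfold regLambda; fun_prop) (.fun_inv ?_ (hN i))
    unfold numeratorR; fun_prop
  unfold regKernel; fun_prop

lemma differentiableAt_regKernel_right (hN : ∀ i, numeratorR h γ μ w v i ≠ 0) :
    DifferentiableAt ℂ (fun v => regKernel h γ φ₁ φ₂ μ w v) v := by
  have hquot (i) : DifferentiableAt ℂ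
      (fun v => regLambda h γ φ₁ φ₂ μ w v i / numeratorR h γ μ w v i) v := by
    simp only [div_eq_mul_inv]
    refine .fun_mul (by unfold regLambda; fun_prop) (.fun_inv ?_ (hN i))
    unfold numeratorR; fun_prop
  unfold regKernel; fun_prop

lemma regKernel_eq_zero_of_factor {i j : Fin n} (hij : i < j)
    (hb : wb (v j - v i) = 0 ∨ wb (w j - w i) = 0) : regKernel h γ φ₁ φ₂ μ w v = 0 := by
  have hprod : ∏ i, ∏ j ∈ Finset.Ioi i, wb (v j - v i) * (wa γ (w j - μ (Fin.castLE h i)) *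
      (wb (w j - w i) * wb (w j - μ (Fin.castLE h i)))) = 0 :=
    Finset.prod_eq_zero (Finset.mem_univ i) (Finset.prod_eq_zero (Finset.mem_Ioi.2 hij) <| by
      rcases hb with hb | hb <;> simp [hb])
  rw [regKernel, hprod, mul_zero, zero_mul]

lemma regKernel_eq_zero (hwv : ¬ Function.Injective w ∨ ¬ Function.Injective v) :
    regKernel h γ φ₁ φ₂ μ w v = 0 := by
  have hwb : wb 0 = 0 := sinh_zero
  simp only [Function.not_injective_iff] at hwv
  rcases hwv with ⟨i, j, heq, hne⟩ | ⟨i, j, heq, hne⟩ <;> rcases hne.lt_or_gt with hij | hij <;>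
    exact regKernel_eq_zero_of_factor hij (by simp [heq, hwb])

lemma BetheEquations.comp_perm {y : Fin n → ℂ} (hy : BetheEquations γ φ₁ φ₂ μ y)
    (π : Equiv.Perm (Fin n)) : BetheEquations γ φ₁ φ₂ μ (y ∘ π) where
  twist_ne_zero := hy.twist_ne_zero
  b_ne_zero i := hy.b_ne_zero (π i)
  a_ne_zero i k hk := hy.a_ne_zero (π i) (π k) (π.injective.ne hk)
  equation i := (hy.equation (π i)).trans <| congrArg _ <| Eq.symm <|
    prod_erase_comp_perm (fun k => wa γ (y (π i) - y k) / wa γ (y k - y (π i))) π i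

end Regularity

section Deformation

variable {N n : ℕ} {Γ : Finset (ℂ × ℝ)}

theorem dense_injective {ι 𝕜 : Type*} [Finite ι] [NontriviallyNormedField 𝕜] [CompleteSpace 𝕜] :
    Dense {p : ι → 𝕜 | Function.Injective p} := by
  have := Fintype.ofFinite ι
  have hopen (i j : ι) : IsOpen {p : ι → 𝕜 | p i = p j → i = j} := by
    rcases eq_or_ne i j with rfl | hij
    · simp
    · simpa [hij] using isOpen_ne_fun (continuous_apply i) (continuous_apply j)
  have hdense (i j : ι) : Dense {p : ι → 𝕜 | p i = p j → i = j} := by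
    classical
    rcases eq_or_ne i j with rfl | hij
    · simp
    · set φ : (ι → 𝕜) →L[𝕜] 𝕜 := .proj i - .proj j
      have hφ : Function.Surjective φ := fun z => ⟨Pi.single i z, by simp [φ, hij.symm]⟩
      refine ((dense_compl_singleton 0).preimage (φ.isOpenMap hφ)).mono fun p hp heq => ?_
      exact (hp (by simp [φ, heq])).elim
  have hset : {p : ι → 𝕜 | Function.Injective p} = ⋂ i, ⋂ j, {p | p i = p j → i = j} := by
    ext; simp [Function.Injective]
  rw [hset]
  exact dense_iInter_of_isOpen (fun i => isOpen_iInter_of_finite (hopen i))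
    fun i => dense_iInter_of_isOpen (hopen i) (hdense i)

theorem isOpen_encloses (Γ : Finset (ℂ × ℝ)) : IsOpen {p : Fin N → ℂ | Encloses Γ p} := by
  have hcompact : IsCompact (region Γ) :=
    Γ.finite_toSet.isCompact_biUnion fun d _ => isCompact_closedBall d.1 d.2
  refine isOpen_iff_eventually.2 fun p hE => ?_
  have hmem : ∀ᶠ q : Fin N → ℂ in nhds p, ∀ j, ∃ d ∈ Γ, q j ∈ Metric.ball d.1 d.2 := by
    refine Filter.eventually_all.2 fun j => ?_
    obtain ⟨d, hd, hj⟩ := hE.mem j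
    exact ((continuous_apply j).continuousAt.eventually_mem
      (Metric.isOpen_ball.mem_nhds hj)).mono fun q hq => ⟨d, hd, hq⟩
  have hsolely : ∀ᶠ q : Fin N → ℂ in nhds p, ∀ j, ∀ z ∈ region Γ, sinhc (z - q j) ≠ 0 := by
    refine Filter.eventually_all.2 fun j =>
      hcompact.eventually_forall_of_forall_eventually fun z hz => ?_
    have hcont : Continuous fun q : (Fin N → ℂ) × ℂ => sinhc (q.2 - q.1 j) :=
      differentiable_sinhc.continuous.comp (by fun_prop)
    exact hcont.continuousAt.eventually_ne (hE.sinhc_ne_zero hz j)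
  filter_upwards [hmem, hsolely] with q hqmem hq
  refine ⟨hE.radius_pos, hE.disjoint, hqmem, fun z hz j hb => ?_⟩
  rw [wb_eq_mul_sinhc] at hb
  exact sub_eq_zero.1 ((mul_eq_zero.1 hb).resolve_right (hq j z hz))

theorem continuous_contourIntegral_div_prod_wb {f : (Fin n → ℂ) → ℂ}
    (hf : ContinuousOn f (Set.univ.pi fun _ => curve Γ)) :
    Continuous fun p : {p : Fin N → ℂ // Encloses Γ p} =>
      contourIntegral Γ fun w => f w / ∏ i, ∏ j, wb (w i - p.1 j) := by
  have : LocallyCompactSpace {p : Fin N → ℂ // Encloses Γ p} :=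
    (isOpen_encloses Γ).locallyCompactSpace
  unfold contourIntegral torusIntegral
  refine (continuous_finsetSum _ fun d _ =>
    continuous_parametric_integral_of_continuous ?_ isCompact_Icc).div_const _
  set τ := torusMap (fun i => (d i).1.1) fun i => (d i).1.2 with hτ
  have hτc : Continuous τ := by
    rw [hτ]; unfold torusMap; fun_prop
  have hτmem (q : {p : Fin N → ℂ // Encloses Γ p} × (Fin n → ℝ)) :
      τ q.2 ∈ Set.univ.pi fun _ => curve Γ := q.1.2.torusMap_mem_curve d q.2
  have hnum : Continuous fun q : {p : Fin N → ℂ // Encloses Γ p} × (Fin n → ℝ) => f (τ q.2) :=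
    hf.comp_continuous (hτc.comp continuous_snd) hτmem
  have hden : Continuous fun q : {p : Fin N → ℂ // Encloses Γ p} × (Fin n → ℝ) =>
      ∏ i, ∏ j, wb (τ q.2 i - q.1.1 j) :=
    continuous_finsetProd _ fun i _ => continuous_finsetProd _ fun j _ =>
      differentiable_wb.continuous.comp <|
        ((continuous_apply i).comp (hτc.comp continuous_snd)).sub
          ((continuous_apply j).comp (continuous_subtype_val.comp continuous_fst))
  have hden_ne (q : {p : Fin N → ℂ // Encloses Γ p} × (Fin n → ℝ)) :
      ∏ i, ∏ j, wb (τ q.2 i - q.1.1 j) ≠ 0 :=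
    Finset.prod_ne_zero_iff.2 fun i _ => Finset.prod_ne_zero_iff.2 fun j _ =>
      q.1.2.wb_ne_zero (hτmem q i (Set.mem_univ i)) j
  have hjac : Continuous fun q : {p : Fin N → ℂ // Encloses Γ p} × (Fin n → ℝ) =>
      ∏ i, (d i).1.2 * cexp (q.2 i * I) * I := by fun_prop
  exact hjac.smul (hnum.div hden hden_ne)

end Deformation

section ContourIntegral

variable {L n : ℕ} {h : n ≤ L} {γ φ₁ φ₂ : ℂ} {μ : Fin L → ℂ} {x y : Fin n → ℂ}
  {ΓC ΓB : Finset (ℂ × ℝ)}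

lemma continuous_scalarProduct (γ : ℂ) (μ : Fin L → ℂ) (y : Fin n → ℂ) :
    Continuous fun x => scalarProduct γ μ x y := by
  have hC (i : Fin n) : Continuous fun x : Fin n → ℂ => opC γ μ (x i) :=
    ((continuous_apply_apply 1 0).comp (continuous_monodromy γ μ)).comp (continuous_apply i)
  have hprod : Continuous fun x : Fin n → ℂ => (List.ofFn fun i => opC γ μ (x i)).prod := by
    simp only [List.ofFn_eq_map]
    exact continuous_list_prod _ fun i _ => hC i
  exact continuous_const.dotProduct ((hprod.mul continuous_const).matrix_mulVec continuous_const)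

/-- The on-shell kernel integrated over the variables `w̄`, as a sum of residues. -/
noncomputable def innerKernel (h : n ≤ L) (γ φ₁ φ₂ : ℂ) (μ : Fin L → ℂ) (y w : Fin n → ℂ) : ℂ :=
  (∑ ρ : Equiv.Perm (Fin n), regKernel h γ φ₁ φ₂ μ w (y ∘ ρ)) / hypDiscr y

lemma contourIntegral_kernelON (hB : Encloses ΓB y) (hy : Function.Injective y)
    {w : Fin n → ℂ} (hr : ∀ v, (∀ i, v i ∈ curve ΓB) → RegularAt h γ μ w v)
    (hN : ∀ v, (∀ i, v i ∈ region ΓB) → ∀ i, numeratorR h γ μ w v i ≠ 0) :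
    contourIntegral ΓB (fun v => kernelON h γ φ₁ φ₂ μ w v /
        ∏ i, ∏ j, wb (w i - x j) * wb (v i - y j)) =
      innerKernel h γ φ₁ φ₂ μ y w / ∏ i, ∏ j, wb (w i - x j) := by
  have hreg : Set.EqOn
      (fun v => kernelON h γ φ₁ φ₂ μ w v / ∏ i, ∏ j, wb (w i - x j) * wb (v i - y j))
      (fun v => regKernel h γ φ₁ φ₂ μ w v * (∏ i, ∏ j, wb (w i - x j))⁻¹ /
        ∏ i, ∏ j, wb (v i - y j)) (Set.univ.pi fun _ => curve ΓB) := by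
    intro v hv
    simp only [(hr v fun i => hv i (Set.mem_univ i)).kernelON_eq_regKernel, Finset.prod_mul_distrib,
      ← div_div, ← div_eq_mul_inv]
  rw [hB.contourIntegral_congr hreg, hB.contourIntegral_div_prod_wb_eq_sum_perm hy,
    ← Finset.sum_mul, ← div_eq_mul_inv, div_right_comm, innerKernel]
  · exact fun v hv => ((differentiableAt_regKernel_right <| hN v fun i =>
      hv i (Set.mem_univ i)).mul_const _).differentiableWithinAt
  · intro σ hσ
    rw [regKernel_eq_zero (.inr fun hinj => hσ hinj.of_comp), zero_mul]

lemma differentiableOn_innerKernel (hB : Encloses ΓB y)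
    (hN : ∀ w v : Fin n → ℂ, (∀ i, w i ∈ region ΓC) → (∀ i, v i ∈ region ΓB) →
      ∀ i, numeratorR h γ μ w v i ≠ 0) :
    DifferentiableOn ℂ (innerKernel h γ φ₁ φ₂ μ y) (Set.univ.pi fun _ => region ΓC) := by
  unfold innerKernel
  simp only [div_eq_mul_inv]
  refine .mul_const (.fun_sum fun ρ _ => ?_) _
  exact fun w hw => (differentiableAt_regKernel_left <| hN w _
    (fun i => hw i (Set.mem_univ i)) fun i => hB.mem_region (ρ i)).differentiableWithinAt

lemma innerKernel_eq_zero {w : Fin n → ℂ} (hw : ¬ Function.Injective w) :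
    innerKernel h γ φ₁ φ₂ μ y w = 0 := by
  simp only [innerKernel, regKernel_eq_zero (.inl hw), Finset.sum_const_zero, zero_div]

lemma scalarProduct_eq_contourIntegral_of_injective (hy : Function.Injective y)
    (hBA : BetheEquations γ φ₁ φ₂ μ y) (hC : Encloses ΓC x) (hx : Function.Injective x)
    (hB : Encloses ΓB y)
    (hN : ∀ w v : Fin n → ℂ, (∀ i, w i ∈ region ΓC) → (∀ i, v i ∈ region ΓB) →
      ∀ i, numeratorR h γ μ w v i ≠ 0) :
    scalarProduct γ μ x y = contourIntegral ΓC fun w =>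
      innerKernel h γ φ₁ φ₂ μ y w / ∏ i, ∏ j, wb (w i - x j) := by
  rw [hC.contourIntegral_div_prod_wb_eq_sum_perm hx (differentiableOn_innerKernel hB hN)
      fun σ hσ => innerKernel_eq_zero fun hinj => hσ hinj.of_comp,
    scalarProduct_eq_sum_perm h γ μ (hC.separated hx) (hB.separated hy) fun π ρ =>
      hN _ _ (fun i => hC.mem_region (π i)) fun i => hB.mem_region (ρ i)]
  simp only [innerKernel, (hBA.comp_perm _).regKernel_eq_offKernel, ← Finset.sum_div, div_div,
    mul_comm]

theorem scalarProduct_eq_contourIntegral_innerKernel (hy : Function.Injective y)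
    (hBA : BetheEquations γ φ₁ φ₂ μ y) (hC : Encloses ΓC x) (hB : Encloses ΓB y)
    (hN : ∀ w v : Fin n → ℂ, (∀ i, w i ∈ region ΓC) → (∀ i, v i ∈ region ΓB) →
      ∀ i, numeratorR h γ μ w v i ≠ 0) :
    scalarProduct γ μ x y = contourIntegral ΓC fun w =>
      innerKernel h γ φ₁ φ₂ μ y w / ∏ i, ∏ j, wb (w i - x j) := by
  have hdense : Dense {p : {p : Fin n → ℂ // Encloses ΓC p} | Function.Injective p.1} :=
    dense_injective.preimage (isOpen_encloses ΓC).isOpenMap_subtype_val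
  have hcont : ContinuousOn (innerKernel h γ φ₁ φ₂ μ y) (Set.univ.pi fun _ => curve ΓC) :=
    (differentiableOn_innerKernel hB hN).continuousOn.mono
      (Set.pi_mono fun _ _ => curve_subset_region)
  exact congrFun (((continuous_scalarProduct γ μ y).comp continuous_subtype_val).ext_on hdense
    (continuous_contourIntegral_div_prod_wb hcont) fun p hp =>
      scalarProduct_eq_contourIntegral_of_injective hy hBA p.2 hp hB hN) ⟨x, hC⟩

theorem scalarProduct_eq_contourIntegral_kernelON (hy : Function.Injective y)
    (hBA : BetheEquations γ φ₁ φ₂ μ y) (hC : Encloses ΓC x) (hB : Encloses ΓB y)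
    (hr : ∀ w v : Fin n → ℂ, (∀ i, w i ∈ curve ΓC) → (∀ i, v i ∈ curve ΓB) →
      RegularAt h γ μ w v)
    (hN : ∀ w v : Fin n → ℂ, (∀ i, w i ∈ region ΓC) → (∀ i, v i ∈ region ΓB) →
      ∀ i, numeratorR h γ μ w v i ≠ 0) :
    scalarProduct γ μ x y = contourIntegral ΓC fun w => contourIntegral ΓB fun v =>
      kernelON h γ φ₁ φ₂ μ w v / ∏ i, ∏ j, wb (w i - x j) * wb (v i - y j) := by
  rw [scalarProduct_eq_contourIntegral_innerKernel hy hBA hC hB hN]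
  refine hC.contourIntegral_congr fun w hw => (contourIntegral_kernelON hB hy ?_ ?_).symm
  · exact fun v => hr w v fun i => hw i (Set.mem_univ i)
  · exact fun v => hN w v fun i => curve_subset_region (hw i (Set.mem_univ i))

end ContourIntegral

end SixVertex

theorem mainTheorem3 {L n : ℕ} (hn : 1 ≤ n) (hnL : n ≤ L) (γ φ₁ φ₂ : ℂ) (μ : Fin L → ℂ)
    (lamC lamB : Fin n → ℂ) (hB : Function.Injective lamB)
    (hBA : SixVertex.BetheEquations γ φ₁ φ₂ μ lamB) :
    (∀ ΓC ΓB : Finset (ℂ × ℝ),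
      SixVertex.Encloses ΓC lamC → SixVertex.Encloses ΓB lamB →
      (∀ w v : Fin n → ℂ, (∀ i, w i ∈ SixVertex.curve ΓC) → (∀ i, v i ∈ SixVertex.curve ΓB) →
        SixVertex.RegularAt hnL γ μ w v) →
      (∀ w v : Fin n → ℂ, (∀ i, w i ∈ SixVertex.region ΓC) → (∀ i, v i ∈ SixVertex.region ΓB) →
        ∀ i, SixVertex.numeratorR hnL γ μ w v i ≠ 0) →
      SixVertex.scalarProduct γ μ lamC lamB =
        SixVertex.contourIntegral ΓC fun w => SixVertex.contourIntegral ΓB fun v =>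
          SixVertex.kernelON hnL γ φ₁ φ₂ μ w v /
            ∏ i, ∏ j, SixVertex.wb (w i - lamC j) * SixVertex.wb (v i - lamB j)) ∧
    ((∀ s k : Fin L, (s : ℕ) + 1 < n → s < k →
        SixVertex.wa γ (μ s - μ k) ≠ 0 ∧ SixVertex.wa γ (μ k - μ s) ≠ 0) →
      ∀ w v : Fin n → ℂ,
        SixVertex.kernelON hnL γ φ₁ φ₂ μ w v =
          SixVertex.recNorm hnL γ μ * SixVertex.kernelRec hnL γ φ₁ φ₂ μ w v 0 hn) := by
  refine ⟨fun ΓC ΓB hC hE hr hN => ?_, fun hμ w v => ?_⟩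
  · exact SixVertex.scalarProduct_eq_contourIntegral_kernelON hB hBA hC hE hr hN
  · exact SixVertex.kernelON_eq_recNorm_mul_kernelRec hnL γ φ₁ φ₂ μ w v hn hμ
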